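/- Consider $m$ divisible goods and a discrete distribution $\mathcal D$ of user types $k=1,\dots,K$: type $k$ has budget $\tilde w_k>0$ and utility vector $\tilde u_k\in\mathbb R^m_{\ge 0}$ and occurs with probability $q_k\ge 0$, $\sum_k q_k=1$. Assume that for every good $j$ a user has $u_j>0$ with positive probability, and that every type with $q_k>0$ has positive utility for at least one good. Fix vectors $0<\Delta<d$ in $\mathbb R^m$. For a capacity vector $b>0$ let $CE(b)$ be the certainty equivalent Eisenberg–Gale program: maximize $\sum_k q_k\tilde w_k\log(\tilde u_k^\top z_k)$ over $z_1,\dots,z_K\in\mathbb R^m_{\ge 0}$ subject to $\sum_k q_k z_k\le b$. For $n\ge 1$, let $n$ users arrive one after the other, with types $k_1,\dots,k_n$ drawn independently from the known distribution $\mathcal D$, and let the capacities be $c=nd$. Adaptive expected equilibrium pricing proceeds as follows. When user $t$ arrives, let $d_t=\big(c-\sum_{s<t}x_s\big)/(n-t+1)$ be the average remaining capacities, and let $b_t=d_t$ if $d_s\in[d-\Delta,d+\Delta]$ for all $s\le t$, and $b_t=d$ otherwise. Before the type of user $t$ is observed, and depending only on $\mathcal D$, $n$, $d$, $\Delta$ and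 the past, the algorithm takes optimal dual variables $p^t$ of the capacity constraints of $CE(b_t)$ as the prices, and an optimal solution $(z_1,\dots,z_K)$ of $CE(b_t)$; user $t$ consumes $x_t=z_{k_t}$. Ties among optimal solutions may be broken arbitrarily. Then there are constants $\underline p,\bar p>0$ and $C$, which depend only on $\mathcal D$, $d$ and $\Delta$, such that for all $n\ge 1$ and every such execution of the algorithm: almost surely, for every user $t$, all prices satisfy $\underline p\le p^t_j\le\bar p$, and $x_t$ maximizes $u_t^\top x$ over $x\ge 0$ with $(p^t)^\top x\le w_t$, where $(w_t,u_t)=(\tilde w_{k_t},\tilde u_{k_t})$; the expected constraint violation satisfies $$\mathbb E\Big[\big\|\big(\textstyle\sum_{t=1}^n x_t-c\big)_+\big\|_2\Big]\le C;$$ and, for $n\ge 2$, the expected regret satisfies $$\mathbb E\Big[U_n^*-\sum_{t=1}^n w_t\log(u_t^\top x_t)\Big]\le C\log n,$$ where $U_n^*$ is the maximum of $\sum_{t=1}^n w_t\log(u_t^\top y_t)$ over $y_1,\dots,y_n\in\mathbb R^m_{\ge 0}$ with $\sum_t y_t\le c$. -/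

import Mathlib

open MeasureTheory ProbabilityTheory

/-- A discrete distribution of user types in a Fisher market with `m` divisible goods and linear
utilities: type `k` has budget `budget k > 0`, utility coefficients `util k ≥ 0`, and occurs with
probability `prob k`. -/
structure FisherMarket (m K : ℕ) where
  budget : Fin K → ℝ
  util : Fin K → Fin m → ℝ
  prob : Fin K → ℝ
  budget_pos : ∀ k, 0 < budget k
  util_nonneg : ∀ k j, 0 ≤ util k j
  prob_nonneg : ∀ k, 0 ≤ prob k
  prob_sum : ∑ k, prob k = 1

/-- `x` solves the problem of a user with budget `w` and utility coefficients `u` at prices `p`: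
maximize `u · x` subject to `p · x ≤ w` and `x ≥ 0`. -/
def IsUserOptimal {m : ℕ} (w : ℝ) (u p x : Fin m → ℝ) : Prop :=
  ((∀ j, 0 ≤ x j) ∧ ∑ j, p j * x j ≤ w) ∧
    ∀ y : Fin m → ℝ, (∀ j, 0 ≤ y j) → ∑ j, p j * y j ≤ w → ∑ j, u j * y j ≤ ∑ j, u j * x j

/-- The average remaining capacities when user `t` arrives, for `n` users, initial capacities
`n * d`, and consumption `x`. Users are numbered from `0`, so `n - t` users (with user `t`) are
still to be served. -/
noncomputable def avgRemaining {m n : ℕ} (d : Fin m → ℝ) (x : Fin n → Fin m → ℝ) (t : Fin n) :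
    Fin m → ℝ :=
  fun j => ((n : ℝ) * d j - ∑ s ∈ Finset.univ.filter (fun s => s < t), x s j) / ((n : ℝ) - (t : ℕ))

open Classical in
/-- The capacity vector for which the certainty equivalent problem is solved at time `t`: the
average remaining capacities as long as these have stayed in the box `[d - Δ, d + Δ]` up to and
including time `t`, and the initial average capacities `d` otherwise. -/
noncomputable def pricingCapacity {m n : ℕ} (d Δ : Fin m → ℝ) (x : Fin n → Fin m → ℝ)
    (t : Fin n) : Fin m → ℝ :=
  if ∀ s, s ≤ t → avgRemaining d x s ∈ Set.Icc (d - Δ) (d + Δ) then avgRemaining d x t else d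

/-- The allocations along a sequence `κ` of user types, if user `t` receives the entry, for the
type of that user, of an allocation `plan κ t` to all types. -/
def consumption {m K n : ℕ} (plan : (Fin n → Fin K) → Fin n → Fin K → Fin m → ℝ)
    (κ : Fin n → Fin K) : Fin n → Fin m → ℝ :=
  fun t => plan κ t (κ t)

namespace FisherMarket

variable {m K : ℕ} (M : FisherMarket m K)

/-- For each good, users have a strictly positive utility for it with positive probability. -/
def AllGoodsHaveBuyers : Prop :=
  ∀ j, 0 < ∑ k ∈ Finset.univ.filter (fun k => 0 < M.util k j), M.prob k

/-- The utility of type `k` for the bundle `x`. -/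
def utility (k : Fin K) (x : Fin m → ℝ) : ℝ := ∑ j, M.util k j * x j

/-! ### The certainty equivalent problem -/

/-- Nonnegative allocations to the types with a finite objective: since `log 0 = -∞`, the types of
positive probability must receive positive utility. -/
def ceDomain : Set (Fin K → Fin m → ℝ) :=
  {z | (∀ k j, 0 ≤ z k j) ∧ ∀ k, 0 < M.prob k → 0 < M.utility k (z k)}

/-- The objective of the certainty equivalent problem, on its domain. -/
noncomputable def ceObjective (z : Fin K → Fin m → ℝ) : ℝ :=
  ∑ k, M.prob k * M.budget k * Real.log (M.utility k (z k))

/-- `z` is an optimal solution of the certainty equivalent problem with capacities `d`. -/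
def IsCEOptimal (d : Fin m → ℝ) (z : Fin K → Fin m → ℝ) : Prop :=
  (z ∈ M.ceDomain ∧ ∀ j, ∑ k, z k j * M.prob k ≤ d j) ∧
    ∀ y ∈ M.ceDomain, (∀ j, ∑ k, y k j * M.prob k ≤ d j) → M.ceObjective y ≤ M.ceObjective z

/-- The Lagrangian of the certainty equivalent problem, with a multiplier for each capacity
constraint. -/
noncomputable def ceLagrangian (d : Fin m → ℝ) (z : Fin K → Fin m → ℝ) (p : Fin m → ℝ) : ℝ :=
  M.ceObjective z + ∑ j, p j * (d j - ∑ k, z k j * M.prob k)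

/-- The Lagrangian dual function of the certainty equivalent problem. -/
noncomputable def ceDual (d p : Fin m → ℝ) : EReal :=
  ⨆ z ∈ M.ceDomain, ((M.ceLagrangian d z p : ℝ) : EReal)

/-- `p` is a vector of optimal dual variables of the capacity constraints of the certainty
equivalent problem with capacities `d`. -/
def IsCEDualOptimal (d p : Fin m → ℝ) : Prop :=
  (∀ j, 0 ≤ p j) ∧ ∀ p' : Fin m → ℝ, (∀ j, 0 ≤ p' j) → M.ceDual d p ≤ M.ceDual d p'

/-! ### Adaptive expected equilibrium pricing -/

/-- Adaptive expected equilibrium pricing for `n` users with capacities `n * d` and threshold `Δ`.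
Along a sequence `κ` of user types, `price κ t` is the price vector offered to user `t`, and
`plan κ t` is the solution of the certainty equivalent problem from which user `t` receives the
entry for the type of that user. Both are chosen before user `t` arrives: they depend only on the
types of the users that came before. -/
structure IsAdaptivePricing (d Δ : Fin m → ℝ) {n : ℕ}
    (price : (Fin n → Fin K) → Fin n → Fin m → ℝ)
    (plan : (Fin n → Fin K) → Fin n → Fin K → Fin m → ℝ) : Prop where
  price_nonanticipating : ∀ κ κ' t, (∀ s, s < t → κ s = κ' s) → price κ t = price κ' t
  plan_nonanticipating : ∀ κ κ' t, (∀ s, s < t → κ s = κ' s) → plan κ t = plan κ' t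
  price_dual : ∀ κ t, M.IsCEDualOptimal (pricingCapacity d Δ (consumption plan κ) t) (price κ t)
  plan_optimal : ∀ κ t, M.IsCEOptimal (pricingCapacity d Δ (consumption plan κ) t) (plan κ t)

/-! ### Performance measures -/

/-- The objective of the Eisenberg-Gale program for users of types `κ` and allocations `x`. -/
noncomputable def welfare {n : ℕ} (κ : Fin n → Fin K) (x : Fin n → Fin m → ℝ) : ℝ :=
  ∑ t, M.budget (κ t) * Real.log (M.utility (κ t) (x t))

/-- The feasible allocations of the Eisenberg-Gale program with capacities `n * d` at which the
objective is finite. -/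
def offlineFeasible (d : Fin m → ℝ) {n : ℕ} (κ : Fin n → Fin K) : Set (Fin n → Fin m → ℝ) :=
  {x | (∀ t j, 0 ≤ x t j) ∧ (∀ j, ∑ t, x t j ≤ (n : ℝ) * d j) ∧
    ∀ t, 0 < M.utility (κ t) (x t)}

/-- The optimal value of the (offline) Eisenberg-Gale program. -/
noncomputable def offlineOptimum (d : Fin m → ℝ) {n : ℕ} (κ : Fin n → Fin K) : ℝ :=
  sSup (M.welfare κ '' M.offlineFeasible d κ)

/-- The types `T t` of the users are drawn independently from the distribution `M.prob`. -/
structure IsIIDArrivals {Ω : Type*} [MeasurableSpace Ω] (P : Measure Ω) {n : ℕ}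
    (T : Fin n → Ω → Fin K) : Prop where
  measurable : ∀ t, Measurable (T t)
  indep : iIndepFun T P
  law : ∀ t k, P.real {ω | T t ω = k} = M.prob k

/-- The expected regret of the allocations `x κ` made along the type sequences `κ`. -/
noncomputable def expectedRegret (d : Fin m → ℝ) {Ω : Type*} [MeasurableSpace Ω] (P : Measure Ω)
    {n : ℕ} (T : Fin n → Ω → Fin K) (x : (Fin n → Fin K) → Fin n → Fin m → ℝ) : ℝ :=
  ∫ ω, (M.offlineOptimum d (fun t => T t ω)
    - M.welfare (fun t => T t ω) (x (fun t => T t ω))) ∂P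

end FisherMarket

/-- The Euclidean norm of the vector of excess demands for the capacities `n * d`. -/
noncomputable def violation {m n : ℕ} (d : Fin m → ℝ) (x : Fin n → Fin m → ℝ) : ℝ :=
  ‖(WithLp.toLp 2 (fun j => max (∑ t, x t j - (n : ℝ) * d j) 0) : EuclideanSpace ℝ (Fin m))‖

/-- The expected constraint violation of the allocations `x κ` made along the type sequences
`κ`. -/
noncomputable def expectedViolation {m K : ℕ} (d : Fin m → ℝ) {Ω : Type*} [MeasurableSpace Ω]
    (P : Measure Ω) {n : ℕ} (T : Fin n → Ω → Fin K)
    (x : (Fin n → Fin K) → Fin n → Fin m → ℝ) : ℝ :=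
  ∫ ω, violation d (x (fun t => T t ω)) ∂P

/-!
The price vector of the certainty equivalent problem and an optimal allocation satisfy the
Karush-Kuhn-Tucker conditions (`FisherMarket.IsCEOptimal.isEquilibrium`), which say that every user
gets an optimal bundle, that all capacities are used up, and that the prices are bounded away from
zero and infinity as long as the capacities stay in the box. The optimal value `f` of the problem is
a concave function of the capacities with the price as its gradient, and prices are Lipschitz
continuous (`IsEquilibrium.sum_sq_price_sub_le`), so that
`f d - f b ≤ -p · (b - d) + C * ‖b - d‖ ^ 2` (`IsEquilibrium.ceObjective_sub_le`).

Since capacities are used up in expectation, the deviation `η t` of the average remaining capacities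
from `d`, stopped when they leave the box, is a martingale. The increment of user `t` is of order
`1 / (n - t - 1)`, hence the second and fourth moments of `η t` are of order `1 / (n - t)` and
`1 / (n - t) ^ 2` (`pathMean_martingale_moments`).

*Regret.* By weak duality the expected offline optimum is at most `n * f d`, and user `t`
contributes `f (b t)` in expectation. The linear term of the expansion of `f` has mean zero up to the
contribution from outside of the box, which is dominated by `‖η t‖ ^ 2`; the sum of the second
moments over `t` is of order `log n`.

*Violation.* The excess demand is made up of the deviation at the exit from the box times the number
of users left, and of a martingale after the exit. Both are bounded in mean, as the probability of
an exit by time `t` is of order `1 / (n - t) ^ 2`, by the fourth moment.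

The types take finitely many values, so all expectations are finite sums over type sequences
(`FisherMarket.pathMean`).
-/

/-! ### Optimality conditions of the certainty equivalent problem -/

namespace FisherMarket

variable {m K : ℕ} {M : FisherMarket m K}

/-- The Karush-Kuhn-Tucker conditions of the certainty equivalent problem with capacities `b`, in
market form: at the prices `p` every type of positive probability exhausts its budget on bundles of
maximal bang for the buck, and every capacity is used up. The condition `marginal_le` says
`budget * util j / utility ≤ p j`; equality on the support of `z k` follows from `spend`. Nothing
is required of the allocations of types of probability zero, except nonnegativity. -/
structure IsEquilibrium (M : FisherMarket m K) (b p : Fin m → ℝ) (z : Fin K → Fin m → ℝ) :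
    Prop where
  nonneg : ∀ k j, 0 ≤ z k j
  utility_pos : ∀ k, 0 < M.prob k → 0 < M.utility k (z k)
  price_pos : ∀ j, 0 < p j
  marginal_le : ∀ k, 0 < M.prob k → ∀ j, M.budget k * M.util k j ≤ p j * M.utility k (z k)
  spend : ∀ k, 0 < M.prob k → ∑ j, p j * z k j = M.budget k
  clears : ∀ j, ∑ k, z k j * M.prob k = b j

lemma utility_nonneg (k : Fin K) {x : Fin m → ℝ} (hx : ∀ j, 0 ≤ x j) : 0 ≤ M.utility k x :=
  Finset.sum_nonneg fun j _ => mul_nonneg (M.util_nonneg k j) (hx j)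

lemma utility_segment (k : Fin K) (x y : Fin m → ℝ) (ε : ℝ) :
    M.utility k (fun j => x j + ε * (y j - x j))
      = M.utility k x + ε * (M.utility k y - M.utility k x) := by
  unfold utility
  rw [← Finset.sum_sub_distrib, Finset.mul_sum, ← Finset.sum_add_distrib]
  exact Finset.sum_congr rfl fun j _ => by ring

lemma segment_mem_ceDomain {z y : Fin K → Fin m → ℝ} (hz : z ∈ M.ceDomain)
    (hy : ∀ k j, 0 ≤ y k j) {ε : ℝ} (h0 : 0 < ε) (h1 : ε < 1) :
    (fun k j => z k j + ε * (y k j - z k j)) ∈ M.ceDomain := by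
  refine ⟨fun k j => ?_, fun k hk => ?_⟩
  · nlinarith [mul_nonneg h0.le (hy k j), mul_nonneg (sub_nonneg.2 h1.le) (hz.1 k j)]
  · rw [utility_segment]
    nlinarith [mul_nonneg h0.le (utility_nonneg (M := M) k (hy k)),
      mul_pos (sub_pos.2 h1) (hz.2 k hk)]

open Filter Topology in
/-- First-order condition at `z` along the segment to `y`: if the objective grows at most at rate
`l` from `z` towards `y`, then its directional derivative is at most `l`. The type-wise utilities
`y k` may vanish, so that `y` need not belong to the domain. -/
lemma sum_utility_ratio_le {z y : Fin K → Fin m → ℝ} (hz : z ∈ M.ceDomain)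
    (hy : ∀ k j, 0 ≤ y k j) {l : ℝ}
    (h : ∀ ε, 0 < ε → ε < 1 →
      M.ceObjective (fun k j => z k j + ε * (y k j - z k j)) ≤ M.ceObjective z + ε * l) :
    ∑ k, M.prob k * M.budget k * (M.utility k (y k) / M.utility k (z k) - 1) ≤ l := by
  set c : Fin K → ℝ := fun k => M.utility k (y k) / M.utility k (z k) - 1 with hc
  have key : ∀ ε, 0 < ε → ε < 1 →
      ∑ k, M.prob k * M.budget k * (c k / (1 + ε * c k)) ≤ l := by
    intro ε h0 h1
    have hterm : ∀ k, ε * (M.prob k * M.budget k * (c k / (1 + ε * c k))) ≤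
        M.prob k * M.budget k * Real.log (M.utility k (fun j => z k j + ε * (y k j - z k j)))
        - M.prob k * M.budget k * Real.log (M.utility k (z k)) := by
      intro k
      rcases (M.prob_nonneg k).eq_or_lt with hk | hk
      · simp [← hk]
      have hU := hz.2 k hk
      have hc1 : -1 ≤ c k := by
        have : 0 ≤ M.utility k (y k) / M.utility k (z k) :=
          div_nonneg (utility_nonneg k (hy k)) hU.le
        simp only [hc]; linarith
      have hpos : 0 < 1 + ε * c k := by nlinarith
      have hUe : M.utility k (fun j => z k j + ε * (y k j - z k j))
          = M.utility k (z k) * (1 + ε * c k) := by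
        rw [utility_segment]; simp only [hc]; field_simp
      rw [hUe, Real.log_mul hU.ne' hpos.ne', mul_add, add_sub_cancel_left]
      have := Real.one_sub_inv_le_log_of_pos hpos
      have h2 : ε * (c k / (1 + ε * c k)) = 1 - (1 + ε * c k)⁻¹ := by field_simp; ring
      calc ε * (M.prob k * M.budget k * (c k / (1 + ε * c k)))
          = M.prob k * M.budget k * (ε * (c k / (1 + ε * c k))) := by ring
        _ ≤ _ := by
          rw [h2]
          exact mul_le_mul_of_nonneg_left this (mul_nonneg hk.le (M.budget_pos k).le)
    have hsum := Finset.sum_le_sum fun k (_ : k ∈ Finset.univ) => hterm k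
    rw [← Finset.mul_sum, Finset.sum_sub_distrib] at hsum
    have := h ε h0 h1
    unfold ceObjective at this
    exact le_of_mul_le_mul_left (by linarith) h0
  have hlim : Tendsto (fun ε : ℝ => ∑ k, M.prob k * M.budget k * (c k / (1 + ε * c k)))
      (𝓝[>] 0) (𝓝 (∑ k, M.prob k * M.budget k * c k)) := by
    have : ContinuousAt
        (fun ε : ℝ => ∑ k, M.prob k * M.budget k * (c k / (1 + ε * c k))) 0 := by
      refine tendsto_finsetSum _ fun k _ => ?_
      have : ContinuousAt (fun ε : ℝ => M.prob k * M.budget k * (c k / (1 + ε * c k))) 0 := by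
        apply ContinuousAt.mul continuousAt_const
        apply ContinuousAt.div continuousAt_const (by fun_prop)
        simp
      exact this
    have h2 := this.tendsto
    simp only [zero_mul, add_zero, div_one] at h2
    exact h2.mono_left nhdsWithin_le_nhds
  refine le_of_tendsto hlim ?_
  filter_upwards [Ioo_mem_nhdsGT (zero_lt_one' ℝ)] with ε hε using key ε hε.1 hε.2

lemma AllGoodsHaveBuyers.exists_buyer (h : M.AllGoodsHaveBuyers) (j : Fin m) :
    ∃ k, 0 < M.prob k ∧ 0 < M.util k j := by
  by_contra! hno
  exact (h j).not_ge <| Finset.sum_nonpos fun k hk =>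
    not_lt.1 fun hpos => (hno k hpos).not_gt (Finset.mem_filter.1 hk).2

lemma exists_prob_pos (M : FisherMarket m K) : ∃ k, 0 < M.prob k := by
  by_contra! h
  have := Finset.sum_nonpos fun k (_ : k ∈ Finset.univ) => h k
  linarith [M.prob_sum]

/-- The tangent bound for `log` at `x`, with the marginal utilities bounded by the prices. It gives
weak duality for the certainty equivalent problem and, summed over users, for the offline one. -/
lemma budget_mul_log_le {k : Fin K} {p x y : Fin m → ℝ} (hx : 0 < M.utility k x)
    (hle : ∀ j, M.budget k * M.util k j ≤ p j * M.utility k x)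
    (hy : ∀ j, 0 ≤ y j) (hy' : 0 < M.utility k y) :
    M.budget k * Real.log (M.utility k y)
      ≤ M.budget k * Real.log (M.utility k x) + ∑ j, p j * y j - M.budget k := by
  have h1 := Real.log_le_sub_one_of_pos (div_pos hy' hx)
  rw [Real.log_div hy'.ne' hx.ne'] at h1
  have h2 : M.budget k * (M.utility k y / M.utility k x) ≤ ∑ j, p j * y j := by
    rw [← mul_div_assoc, div_le_iff₀ hx, Finset.sum_mul, utility, Finset.mul_sum]
    refine Finset.sum_le_sum fun j _ => ?_
    nlinarith [mul_le_mul_of_nonneg_right (hle j) (hy j)]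
  nlinarith [mul_le_mul_of_nonneg_left h1 (M.budget_pos k).le]

lemma sum_price_mul_demand (p : Fin m → ℝ) (y : Fin K → Fin m → ℝ) :
    ∑ j, p j * ∑ k, y k j * M.prob k = ∑ k, M.prob k * ∑ j, p j * y k j := by
  simp_rw [Finset.mul_sum]
  rw [Finset.sum_comm]
  exact Finset.sum_congr rfl fun k _ => Finset.sum_congr rfl fun j _ => by ring

lemma ceLagrangian_eq (d p : Fin m → ℝ) (z : Fin K → Fin m → ℝ) :
    M.ceLagrangian d z p
      = M.ceObjective z + ∑ j, p j * d j - ∑ k, M.prob k * ∑ j, p j * z k j := by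
  rw [← sum_price_mul_demand]
  unfold ceLagrangian
  simp_rw [mul_sub, Finset.sum_sub_distrib]
  ring

lemma ceObjective_le_of_marginal_le {p : Fin m → ℝ} {z y : Fin K → Fin m → ℝ}
    (hz : z ∈ M.ceDomain)
    (hle : ∀ k, 0 < M.prob k → ∀ j, M.budget k * M.util k j ≤ p j * M.utility k (z k))
    (hy : y ∈ M.ceDomain) :
    M.ceObjective y ≤ M.ceObjective z + ∑ k, M.prob k * ∑ j, p j * y k j
      - ∑ k, M.prob k * M.budget k := by
  unfold ceObjective
  rw [← Finset.sum_add_distrib, ← Finset.sum_sub_distrib]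
  refine Finset.sum_le_sum fun k _ => ?_
  rcases (M.prob_nonneg k).eq_or_lt with hk | hk
  · simp [← hk]
  have := budget_mul_log_le (hz.2 k hk) (hle k hk) (hy.1 k) (hy.2 k hk)
  nlinarith [mul_le_mul_of_nonneg_left this hk.le]

/-- Strong duality for the certainty equivalent problem: the multiplier of good `j` is the largest
of the marginal values `budget k * util k j / utility k (z k)`. -/
lemma IsCEOptimal.exists_multiplier {b : Fin m → ℝ}
    (hb : ∀ j, 0 < b j) {z : Fin K → Fin m → ℝ} (hz : M.IsCEOptimal b z) :
    ∃ p : Fin m → ℝ, (∀ j, 0 ≤ p j) ∧ M.ceDual b p ≤ (M.ceObjective z : EReal) := by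
  obtain ⟨⟨hdom, hcap⟩, hmax⟩ := hz
  set β : Fin K → ℝ := fun k => M.budget k / M.utility k (z k) with hβ
  have hbest : ∀ j, ∃ k, 0 < M.prob k ∧
      ∀ l, 0 < M.prob l → β l * M.util l j ≤ β k * M.util k j := by
    intro j
    obtain ⟨k₀, hk₀⟩ := M.exists_prob_pos
    obtain ⟨k, hk, hk'⟩ := (Finset.univ.filter fun k => 0 < M.prob k).exists_max_image
      (fun k => β k * M.util k j) ⟨k₀, by simp [hk₀]⟩
    exact ⟨k, by simpa using hk, fun l hl => hk' l (by simp [hl])⟩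
  choose best hbest_pos hbest using hbest
  set p : Fin m → ℝ := fun j => β (best j) * M.util (best j) j with hp
  have hβpos : ∀ k, 0 < M.prob k → 0 < β k := fun k hk =>
    div_pos (M.budget_pos k) (hdom.2 k hk)
  have hp0 : ∀ j, 0 ≤ p j := fun j =>
    mul_nonneg (hβpos _ (hbest_pos j)).le (M.util_nonneg _ _)
  have hle : ∀ k, 0 < M.prob k → ∀ j, M.budget k * M.util k j ≤ p j * M.utility k (z k) := by
    intro k hk j
    have h1 := mul_le_mul_of_nonneg_right (hbest j k hk) (hdom.2 k hk).le
    have h2 : β k * M.util k j * M.utility k (z k) = M.budget k * M.util k j := by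
      have := (hdom.2 k hk).ne'
      simp only [hβ]; field_simp
    linarith
  -- all of good `j` goes to a type that attains the maximum in the definition of `p j`
  set y : Fin K → Fin m → ℝ := fun k j => if k = best j then b j / M.prob k else 0 with hy
  have hy0 : ∀ k j, 0 ≤ y k j := by
    intro k j
    simp only [hy]; split_ifs
    · exact div_nonneg (hb j).le (M.prob_nonneg k)
    · exact le_rfl
  have hycap : ∀ j, ∑ k, y k j * M.prob k = b j := by
    intro j
    have := (hbest_pos j).ne'
    simp [hy, ite_mul, div_mul_cancel₀ _ this]
  have hfo := sum_utility_ratio_le (l := 0) hdom hy0 fun ε h0 h1 => by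
    rw [mul_zero, add_zero]
    refine hmax _ (segment_mem_ceDomain hdom hy0 h0 h1) fun j => ?_
    have : ∑ k, (z k j + ε * (y k j - z k j)) * M.prob k
        = (1 - ε) * ∑ k, z k j * M.prob k + ε * ∑ k, y k j * M.prob k := by
      rw [Finset.mul_sum, Finset.mul_sum, ← Finset.sum_add_distrib]
      exact Finset.sum_congr rfl fun k _ => by ring
    rw [this, hycap]
    nlinarith [mul_le_mul_of_nonneg_left (hcap j) (sub_nonneg.2 h1.le)]
  have hpb : ∑ k, M.prob k * M.budget k * (M.utility k (y k) / M.utility k (z k))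
      = ∑ j, p j * b j := by
    have h1 : ∀ k, M.prob k * M.budget k * (M.utility k (y k) / M.utility k (z k))
        = ∑ j, β k * M.util k j * (y k j * M.prob k) := by
      intro k
      have : ∑ j, β k * M.util k j * (y k j * M.prob k)
          = β k * M.prob k * M.utility k (y k) := by
        rw [utility, Finset.mul_sum]
        exact Finset.sum_congr rfl fun j _ => by ring
      rw [this]; simp only [hβ]; ring
    simp_rw [h1]
    rw [Finset.sum_comm]
    refine Finset.sum_congr rfl fun j _ => ?_
    rw [← hycap j, Finset.mul_sum]
    refine Finset.sum_congr rfl fun k _ => ?_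
    by_cases h : k = best j
    · simp only [hp, h]
    · simp [hy, h]
  have hpW : ∑ j, p j * b j ≤ ∑ k, M.prob k * M.budget k := by
    simp_rw [mul_sub, mul_one] at hfo
    rw [Finset.sum_sub_distrib, hpb] at hfo
    linarith
  refine ⟨p, hp0, iSup₂_le fun x hx => EReal.coe_le_coe_iff.2 ?_⟩
  rw [ceLagrangian_eq]
  linarith [ceObjective_le_of_marginal_le hdom hle hx]

/-- Optimal allocations and optimal dual variables form an equilibrium. By strong duality `z`
maximizes the Lagrangian at `p`; the conditions are its first-order conditions at `z` towards
`0` (spending) and towards one more unit of a single good for a single type (marginal values). -/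
theorem IsCEOptimal.isEquilibrium (hbuyers : M.AllGoodsHaveBuyers) {b : Fin m → ℝ}
    (hb : ∀ j, 0 < b j) {z : Fin K → Fin m → ℝ} (hz : M.IsCEOptimal b z) {p : Fin m → ℝ}
    (hp : M.IsCEDualOptimal b p) : M.IsEquilibrium b p z := by
  obtain ⟨p', hp'0, hp'⟩ := hz.exists_multiplier hb
  obtain ⟨⟨hdom, hcap⟩, hmax⟩ := hz
  have hL : ∀ y ∈ M.ceDomain, M.ceLagrangian b y p ≤ M.ceObjective z := fun y hy =>
    EReal.coe_le_coe_iff.1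
      ((le_iSup₂ (f := fun y (_ : y ∈ M.ceDomain) => ((M.ceLagrangian b y p : ℝ) : EReal))
        y hy).trans ((hp.2 p' hp'0).trans hp'))
  have hslack0 : ∀ j ∈ Finset.univ, 0 ≤ p j * (b j - ∑ k, z k j * M.prob k) := fun j _ =>
    mul_nonneg (hp.1 j) (sub_nonneg.2 (hcap j))
  have hslack : ∑ j, p j * (b j - ∑ k, z k j * M.prob k) = 0 := by
    refine le_antisymm ?_ (Finset.sum_nonneg hslack0)
    have := hL z hdom
    unfold ceLagrangian at this
    linarith
  have hpz : ∑ k, M.prob k * ∑ j, p j * z k j = ∑ j, p j * b j := by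
    rw [← sum_price_mul_demand]
    simp_rw [mul_sub, Finset.sum_sub_distrib] at hslack
    linarith
  have hfo : ∀ y : Fin K → Fin m → ℝ, (∀ k j, 0 ≤ y k j) →
      ∑ k, M.prob k * M.budget k * (M.utility k (y k) / M.utility k (z k) - 1)
        ≤ ∑ k, M.prob k * ∑ j, p j * (y k j - z k j) := by
    intro y hy
    refine sum_utility_ratio_le hdom hy fun ε h0 h1 => ?_
    have h := hL _ (segment_mem_ceDomain hdom hy h0 h1)
    rw [ceLagrangian_eq, ← hpz] at h
    have h2 : ∑ k, M.prob k * ∑ j, p j * (z k j + ε * (y k j - z k j))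
        = ∑ k, M.prob k * ∑ j, p j * z k j
          + ε * ∑ k, M.prob k * ∑ j, p j * (y k j - z k j) := by
      simp_rw [Finset.mul_sum, ← Finset.sum_add_distrib]
      exact Finset.sum_congr rfl fun k _ => Finset.sum_congr rfl fun j _ => by ring
    linarith
  have hmarg : ∀ k, 0 < M.prob k → ∀ j,
      M.budget k * M.util k j ≤ p j * M.utility k (z k) := by
    intro k hk j
    have h := hfo (fun k' j' => z k' j' + if k' = k ∧ j' = j then 1 else 0) fun k' j' => by
      have := hdom.1 k' j'
      split_ifs <;> linarith
    have hUk : ∀ k', M.prob k' * M.budget k' *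
        (M.utility k' (fun j' => z k' j' + if k' = k ∧ j' = j then 1 else 0)
          / M.utility k' (z k') - 1)
        = if k' = k then M.prob k * M.budget k * (M.util k j / M.utility k (z k)) else 0 := by
      intro k'
      rcases (M.prob_nonneg k').eq_or_lt with hk' | hk'
      · have : k' ≠ k := by rintro rfl; linarith
        simp [← hk', this]
      have hU := (hdom.2 k' hk').ne'
      have h1 : M.utility k' (fun j' => z k' j' + if k' = k ∧ j' = j then 1 else 0)
          = M.utility k' (z k') + if k' = k then M.util k j else 0 := by
        unfold utility
        simp_rw [mul_add, Finset.sum_add_distrib]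
        congr 1
        by_cases hkk : k' = k
        · simp [hkk]
        · simp [hkk]
      rw [h1]
      by_cases hkk : k' = k
      · subst hkk
        simp only [if_true]
        field_simp; ring
      · simp [hkk, div_self hU]
    simp_rw [hUk] at h
    have hR : ∀ k', M.prob k' * ∑ j', p j' * (z k' j' + (if k' = k ∧ j' = j then 1 else 0)
        - z k' j') = if k' = k then M.prob k * p j else 0 := by
      intro k'
      by_cases hkk : k' = k
      · simp [hkk]
      · simp [hkk]
    simp_rw [hR] at h
    simp only [Finset.sum_ite_eq', Finset.mem_univ, if_true] at h
    rw [mul_assoc] at h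
    have h := le_of_mul_le_mul_left h hk
    rwa [← mul_div_assoc, div_le_iff₀ (hdom.2 k hk)] at h
  have hpos : ∀ j, 0 < p j := by
    intro j
    obtain ⟨k, hk, hkj⟩ := hbuyers.exists_buyer j
    have h1 := hmarg k hk j
    have h2 := mul_pos (M.budget_pos k) hkj
    exact pos_of_mul_pos_left (h2.trans_le h1) (hdom.2 k hk).le
  have hspend_ge : ∀ k, 0 < M.prob k → M.budget k ≤ ∑ j, p j * z k j := by
    intro k hk
    have h1 : M.budget k * M.utility k (z k) ≤ (∑ j, p j * z k j) * M.utility k (z k) := by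
      rw [utility, Finset.mul_sum, ← utility, Finset.sum_mul]
      refine Finset.sum_le_sum fun j _ => ?_
      nlinarith [mul_le_mul_of_nonneg_right (hmarg k hk j) (hdom.1 k j)]
    exact le_of_mul_le_mul_right h1 (hdom.2 k hk)
  have hW : ∑ k, M.prob k * ∑ j, p j * z k j ≤ ∑ k, M.prob k * M.budget k := by
    have h := hfo (fun _ _ => 0) fun _ _ => le_rfl
    simp only [utility, mul_zero, Finset.sum_const_zero, zero_div, zero_sub, mul_neg, mul_one,
      Finset.sum_neg_distrib] at h
    linarith
  have hterm : ∀ k ∈ Finset.univ,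
      0 ≤ M.prob k * ∑ j, p j * z k j - M.prob k * M.budget k := by
    intro k _
    rcases (M.prob_nonneg k).eq_or_lt with hk | hk
    · simp [← hk]
    · exact sub_nonneg.2 (mul_le_mul_of_nonneg_left (hspend_ge k hk) hk.le)
  have hzero : ∑ k, (M.prob k * ∑ j, p j * z k j - M.prob k * M.budget k) = 0 := by
    refine le_antisymm ?_ (Finset.sum_nonneg hterm)
    rw [Finset.sum_sub_distrib]; linarith
  refine ⟨hdom.1, hdom.2, hpos, hmarg, fun k hk => ?_, fun j => ?_⟩
  · have := (Finset.sum_eq_zero_iff_of_nonneg hterm).1 hzero k (Finset.mem_univ k)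
    exact mul_left_cancel₀ hk.ne' (sub_eq_zero.1 this)
  · have := (Finset.sum_eq_zero_iff_of_nonneg hslack0).1 hslack j (Finset.mem_univ j)
    have := (mul_eq_zero.1 this).resolve_left (hpos j).ne'
    linarith

end FisherMarket

/-! ### Stability of equilibrium prices -/

namespace FisherMarket

variable {m K : ℕ} {M : FisherMarket m K}

namespace IsEquilibrium

variable {b b' p p' : Fin m → ℝ} {z z' : Fin K → Fin m → ℝ}

lemma mem_ceDomain (h : M.IsEquilibrium b p z) : z ∈ M.ceDomain := ⟨h.nonneg, h.utility_pos⟩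

lemma sum_price_mul_capacity (h : M.IsEquilibrium b p z) :
    ∑ j, p j * b j = ∑ k, M.prob k * M.budget k := by
  simp_rw [← h.clears]
  rw [sum_price_mul_demand]
  refine Finset.sum_congr rfl fun k _ => ?_
  rcases (M.prob_nonneg k).eq_or_lt with hk | hk
  · simp [← hk]
  · rw [h.spend k hk]

lemma capacity_nonneg (h : M.IsEquilibrium b p z) (j : Fin m) : 0 ≤ b j := by
  rw [← h.clears j]
  exact Finset.sum_nonneg fun k _ => mul_nonneg (h.nonneg k j) (M.prob_nonneg k)

lemma allocation_le (h : M.IsEquilibrium b p z) {k : Fin K} (hk : 0 < M.prob k) (j : Fin m) :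
    z k j ≤ b j / M.prob k := by
  rw [le_div_iff₀ hk, ← h.clears j]
  exact Finset.single_le_sum (f := fun k => z k j * M.prob k)
    (fun k _ => mul_nonneg (h.nonneg k j) (M.prob_nonneg k)) (Finset.mem_univ k)

lemma price_le (h : M.IsEquilibrium b p z) {j : Fin m} (hb : 0 < b j) :
    p j ≤ (∑ k, M.prob k * M.budget k) / b j := by
  rw [le_div_iff₀ hb, ← h.sum_price_mul_capacity]
  exact Finset.single_le_sum (f := fun j => p j * b j)
    (fun j _ => mul_nonneg (h.price_pos j).le (h.capacity_nonneg j)) (Finset.mem_univ j)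

lemma le_price (h : M.IsEquilibrium b p z) {k : Fin K} (hk : 0 < M.prob k) {j : Fin m}
    {B : Fin m → ℝ} (hB : ∀ j, b j ≤ B j) :
    M.budget k * M.util k j / M.utility k (fun i => B i / M.prob k) ≤ p j := by
  have hU : M.utility k (z k) ≤ M.utility k (fun i => B i / M.prob k) := by
    refine Finset.sum_le_sum fun i _ => mul_le_mul_of_nonneg_left ?_ (M.util_nonneg k i)
    exact (h.allocation_le hk i).trans (div_le_div_of_nonneg_right (hB i) hk.le)
  rw [div_le_iff₀ ((h.utility_pos k hk).trans_le hU)]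
  exact (h.marginal_le k hk j).trans (mul_le_mul_of_nonneg_left hU (h.price_pos j).le)

lemma marginal_eq (h : M.IsEquilibrium b p z) {k : Fin K} (hk : 0 < M.prob k) {j : Fin m}
    (hj : 0 < z k j) : M.budget k * M.util k j = p j * M.utility k (z k) := by
  have hterm : ∀ i ∈ Finset.univ,
      0 ≤ (p i * M.utility k (z k) - M.budget k * M.util k i) * z k i := fun i _ =>
    mul_nonneg (sub_nonneg.2 (h.marginal_le k hk i)) (h.nonneg k i)
  have hzero : ∑ i, (p i * M.utility k (z k) - M.budget k * M.util k i) * z k i = 0 := by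
    have h1 : ∑ i, (p i * M.utility k (z k) - M.budget k * M.util k i) * z k i
        = (∑ i, p i * z k i) * M.utility k (z k) - M.budget k * ∑ i, M.util k i * z k i := by
      rw [Finset.sum_mul, Finset.mul_sum, ← Finset.sum_sub_distrib]
      exact Finset.sum_congr rfl fun i _ => by ring
    rw [h1, h.spend k hk, ← utility, sub_self]
  have := (Finset.sum_eq_zero_iff_of_nonneg hterm).1 hzero j (Finset.mem_univ j)
  have := (mul_eq_zero.1 this).resolve_right hj.ne'
  linarith

lemma isUserOptimal (h : M.IsEquilibrium b p z) {k : Fin K} (hk : 0 < M.prob k) :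
    IsUserOptimal (M.budget k) (M.util k) p (z k) := by
  refine ⟨⟨h.nonneg k, (h.spend k hk).le⟩, fun y hy hyw => ?_⟩
  have h1 : M.budget k * M.utility k y ≤ M.budget k * M.utility k (z k) := by
    calc M.budget k * M.utility k y = ∑ j, (M.budget k * M.util k j) * y j := by
          rw [utility, Finset.mul_sum]; exact Finset.sum_congr rfl fun j _ => by ring
      _ ≤ ∑ j, (p j * M.utility k (z k)) * y j :=
          Finset.sum_le_sum fun j _ =>
            mul_le_mul_of_nonneg_right (h.marginal_le k hk j) (hy j)
      _ = (∑ j, p j * y j) * M.utility k (z k) := by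
          rw [Finset.sum_mul]; exact Finset.sum_congr rfl fun j _ => by ring
      _ ≤ _ := mul_le_mul_of_nonneg_right hyw (h.utility_pos k hk).le
  exact le_of_mul_le_mul_left h1 (M.budget_pos k)

/-- The price is a supergradient of the optimal value as a function of the capacities. -/
lemma ceObjective_le (h : M.IsEquilibrium b p z) {y : Fin K → Fin m → ℝ}
    (hy : y ∈ M.ceDomain) :
    M.ceObjective y ≤ M.ceObjective z + ∑ j, p j * (∑ k, y k j * M.prob k - b j) := by
  have h1 := ceObjective_le_of_marginal_le h.mem_ceDomain h.marginal_le hy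
  have h2 := sum_price_mul_demand (M := M) p y
  have h3 := h.sum_price_mul_capacity
  simp_rw [mul_sub, Finset.sum_sub_distrib]
  linarith

/-- Where type `k` buys good `j` at the prices `p`, its utility is determined by `p j`, whereas at
`p'` it can do at least as well as by buying `j` only; so its utility falls by a factor of at most
`p' j / p j`. -/
lemma ceObjective_sub_le_log (h : M.IsEquilibrium b p z) (h' : M.IsEquilibrium b' p' z') :
    M.ceObjective z - M.ceObjective z'
      ≤ ∑ j, p j * b j * (Real.log (p' j) - Real.log (p j)) := by
  have hR : ∑ j, p j * b j * (Real.log (p' j) - Real.log (p j))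
      = ∑ k, M.prob k * ∑ j, (p j * (Real.log (p' j) - Real.log (p j))) * z k j := by
    rw [← sum_price_mul_demand]
    exact Finset.sum_congr rfl fun j _ => by rw [h.clears]; ring
  rw [hR, ceObjective, ceObjective, ← Finset.sum_sub_distrib]
  refine Finset.sum_le_sum fun k _ => ?_
  rcases (M.prob_nonneg k).eq_or_lt with hk | hk
  · simp [← hk]
  rw [mul_assoc, mul_assoc, ← mul_sub]
  refine mul_le_mul_of_nonneg_left ?_ hk.le
  rw [← mul_sub, ← h.spend k hk, Finset.sum_mul]
  refine Finset.sum_le_sum fun j _ => ?_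
  rcases (h.nonneg k j).eq_or_lt with hj | hj
  · simp [← hj]
  have hU := h.utility_pos k hk
  have hU' := h'.utility_pos k hk
  have h1 : p j * M.utility k (z k) ≤ p' j * M.utility k (z' k) := by
    rw [← h.marginal_eq hk hj]; exact h'.marginal_le k hk j
  have h2 := Real.log_le_log (mul_pos (h.price_pos j) hU) h1
  rw [Real.log_mul (h.price_pos j).ne' hU.ne', Real.log_mul (h'.price_pos j).ne' hU'.ne'] at h2
  nlinarith [mul_le_mul_of_nonneg_left
    (show Real.log (M.utility k (z k)) - Real.log (M.utility k (z' k))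
      ≤ Real.log (p' j) - Real.log (p j) by linarith) (mul_pos (h.price_pos j) hj).le]

/-- The sum of `ceObjective_sub_le_log` and its copy with the equilibria exchanged: demand is
strongly monotone in the logarithms of the prices. -/
lemma sum_sub_mul_log_le (h : M.IsEquilibrium b p z) (h' : M.IsEquilibrium b' p' z') :
    ∑ j, b' j * ((p' j - p j) * (Real.log (p' j) - Real.log (p j)))
      ≤ ∑ j, p j * ((b j - b' j) * (Real.log (p' j) - Real.log (p j))) := by
  have h1 := h.ceObjective_sub_le_log h'
  have h2 := h'.ceObjective_sub_le_log h
  rw [← sub_nonneg, ← Finset.sum_sub_distrib]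
  have h3 := add_le_add h1 h2
  rw [← Finset.sum_add_distrib] at h3
  have h4 : ∑ j, (p j * b j * (Real.log (p' j) - Real.log (p j))
        + p' j * b' j * (Real.log (p j) - Real.log (p' j)))
      = ∑ j, (p j * ((b j - b' j) * (Real.log (p' j) - Real.log (p j)))
        - b' j * ((p' j - p j) * (Real.log (p' j) - Real.log (p j)))) :=
    Finset.sum_congr rfl fun j _ => by ring
  linarith

end IsEquilibrium

lemma sq_sub_div_le_mul_log_sub {a c u : ℝ} (ha : 0 < a) (hc : 0 < c) (hau : a ≤ u) (hcu : c ≤ u) :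
    (a - c) ^ 2 / u ≤ (a - c) * (Real.log a - Real.log c) := by
  have hu := ha.trans_le hau
  have h1 := Real.one_sub_inv_le_log_of_pos (div_pos ha hc)
  have h2 := Real.one_sub_inv_le_log_of_pos (div_pos hc ha)
  rw [Real.log_div ha.ne' hc.ne', inv_div] at h1
  rw [Real.log_div hc.ne' ha.ne', inv_div] at h2
  rw [div_le_iff₀ hu]
  rcases le_total c a with h | h
  · have h3 : (a - c) / u ≤ 1 - c / a := by
      rw [one_sub_div ha.ne']
      exact div_le_div_of_nonneg_left (by linarith) ha hau
    have h4 : a - c ≤ (Real.log a - Real.log c) * u := by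
      rw [← div_le_iff₀ hu]; linarith
    nlinarith
  · have h3 : (c - a) / u ≤ 1 - a / c := by
      rw [one_sub_div hc.ne']
      exact div_le_div_of_nonneg_left (by linarith) hc hcu
    have h4 : c - a ≤ (Real.log c - Real.log a) * u := by
      rw [← div_le_iff₀ hu]; linarith
    nlinarith

lemma abs_log_sub_le {a c l : ℝ} (hl : 0 < l) (ha : l ≤ a) (hc : l ≤ c) :
    |Real.log a - Real.log c| ≤ |a - c| / l := by
  have ha' := hl.trans_le ha
  have hc' := hl.trans_le hc
  have h1 := Real.log_le_sub_one_of_pos (div_pos ha' hc')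
  have h2 := Real.log_le_sub_one_of_pos (div_pos hc' ha')
  rw [Real.log_div ha'.ne' hc'.ne', div_sub_one hc'.ne'] at h1
  rw [Real.log_div hc'.ne' ha'.ne', div_sub_one ha'.ne'] at h2
  have h3 : (a - c) / c ≤ |a - c| / l :=
    (div_le_div_of_nonneg_right (le_abs_self _) hc'.le).trans
      (div_le_div_of_nonneg_left (abs_nonneg _) hl hc)
  have h4 : (c - a) / a ≤ |a - c| / l := by
    rw [abs_sub_comm]
    exact (div_le_div_of_nonneg_right (le_abs_self _) ha'.le).trans
      (div_le_div_of_nonneg_left (abs_nonneg _) hl ha)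
  exact abs_le.2 ⟨by linarith, by linarith⟩

namespace IsEquilibrium

variable {b b' p p' : Fin m → ℝ} {z z' : Fin K → Fin m → ℝ}

/-- Equilibrium prices are Lipschitz continuous in the capacities. -/
theorem sum_sq_price_sub_le (h : M.IsEquilibrium b p z) (h' : M.IsEquilibrium b' p' z')
    {l u β : ℝ} (hl : 0 < l) (hβ : 0 < β) (hpl : ∀ j, l ≤ p j) (hpl' : ∀ j, l ≤ p' j)
    (hpu : ∀ j, p j ≤ u) (hpu' : ∀ j, p' j ≤ u) (hb' : ∀ j, β ≤ b' j) :
    ∑ j, (p' j - p j) ^ 2 ≤ (u ^ 2 / (l * β)) ^ 2 * ∑ j, (b' j - b j) ^ 2 := by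
  have key := h.sum_sub_mul_log_le h'
  set a : ℝ := u ^ 2 / (l * β) with ha
  have hlow : ∀ j, β / u * (p' j - p j) ^ 2
      ≤ b' j * ((p' j - p j) * (Real.log (p' j) - Real.log (p j))) := by
    intro j
    have hu := (h.price_pos j).trans_le (hpu j)
    have h1 := sq_sub_div_le_mul_log_sub (h'.price_pos j) (h.price_pos j) (hpu' j) (hpu j)
    have h0 : 0 ≤ (p' j - p j) ^ 2 / u := by positivity
    calc β / u * (p' j - p j) ^ 2 = β * ((p' j - p j) ^ 2 / u) := by ring
      _ ≤ b' j * ((p' j - p j) ^ 2 / u) := mul_le_mul_of_nonneg_right (hb' j) h0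
      _ ≤ _ := mul_le_mul_of_nonneg_left h1 (hβ.le.trans (hb' j))
  have hupp : ∀ j, p j * ((b j - b' j) * (Real.log (p' j) - Real.log (p j)))
      ≤ β / u * ((p' j - p j) ^ 2 / 2 + a ^ 2 * (b' j - b j) ^ 2 / 2) := by
    intro j
    have hu := (h.price_pos j).trans_le (hpu j)
    have h1 := abs_log_sub_le hl (hpl' j) (hpl j)
    calc p j * ((b j - b' j) * (Real.log (p' j) - Real.log (p j)))
        ≤ |p j * ((b j - b' j) * (Real.log (p' j) - Real.log (p j)))| := le_abs_self _
      _ = p j * (|b' j - b j| * |Real.log (p' j) - Real.log (p j)|) := by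
          rw [abs_mul, abs_mul, abs_of_pos (h.price_pos j), abs_sub_comm (b j)]
      _ ≤ u * (|b' j - b j| * (|p' j - p j| / l)) := by
          gcongr
          exact hpu j
      _ = β / u * (a * |b' j - b j| * |p' j - p j|) := by
          rw [ha]; field_simp
      _ ≤ _ := by
          refine mul_le_mul_of_nonneg_left ?_ (by positivity)
          have := two_mul_le_add_sq (a * |b' j - b j|) |p' j - p j|
          rw [mul_pow, sq_abs, sq_abs] at this
          linarith
  have hsum := (Finset.sum_le_sum fun j (_ : j ∈ Finset.univ) => hlow j).trans
    (key.trans (Finset.sum_le_sum fun j (_ : j ∈ Finset.univ) => hupp j))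
  rw [← Finset.mul_sum, ← Finset.mul_sum, Finset.sum_add_distrib] at hsum
  rcases isEmpty_or_nonempty (Fin m) with hm | ⟨⟨j⟩⟩
  · simp
  have hu := (h.price_pos j).trans_le (hpu j)
  have := le_of_mul_le_mul_left hsum (by positivity)
  rw [← Finset.sum_div, ← Finset.sum_div, ← Finset.mul_sum] at this
  linarith

/-- The loss in optimal value from changing the capacities is linear up to a quadratic error: the
supergradient inequality at `b'` together with the Lipschitz continuity of the prices. -/
theorem ceObjective_sub_le (h : M.IsEquilibrium b p z) (h' : M.IsEquilibrium b' p' z')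
    {l u β : ℝ} (hl : 0 < l) (hβ : 0 < β) (hpl : ∀ j, l ≤ p j) (hpl' : ∀ j, l ≤ p' j)
    (hpu : ∀ j, p j ≤ u) (hpu' : ∀ j, p' j ≤ u) (hb' : ∀ j, β ≤ b' j) :
    M.ceObjective z - M.ceObjective z'
      ≤ -∑ j, p j * (b' j - b j)
        + ((u ^ 2 / (l * β)) ^ 2 + 1) / 2 * ∑ j, (b' j - b j) ^ 2 := by
  have h1 := h'.ceObjective_le h.mem_ceDomain
  simp_rw [h.clears] at h1
  have h2 := h.sum_sq_price_sub_le h' hl hβ hpl hpl' hpu hpu' hb'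
  have h3 : ∑ j, p' j * (b j - b' j) ≤ -∑ j, p j * (b' j - b j)
      + ((∑ j, (p' j - p j) ^ 2) / 2 + (∑ j, (b' j - b j) ^ 2) / 2) := by
    rw [← Finset.sum_neg_distrib, Finset.sum_div, Finset.sum_div, ← Finset.sum_add_distrib,
      ← Finset.sum_add_distrib]
    refine Finset.sum_le_sum fun j _ => ?_
    nlinarith [sq_nonneg ((p' j - p j) + (b' j - b j))]
  linarith

end IsEquilibrium

end FisherMarket

/-! ### Partial sums over users -/

/-- The sum of `f s` over `s < t`. The time `t` is a natural number so that `t = n` is allowed. -/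
def partialSum {n : ℕ} (f : Fin n → ℝ) (t : ℕ) : ℝ :=
  ∑ s ∈ Finset.univ.filter (fun s : Fin n => (s : ℕ) < t), f s

lemma partialSum_zero {n : ℕ} (f : Fin n → ℝ) : partialSum f 0 = 0 := by
  simp [partialSum]

lemma partialSum_succ {n : ℕ} (f : Fin n → ℝ) (t : Fin n) :
    partialSum f ((t : ℕ) + 1) = partialSum f t + f t := by
  have h : Finset.univ.filter (fun s : Fin n => (s : ℕ) < t + 1)
      = insert t (Finset.univ.filter (fun s : Fin n => (s : ℕ) < t)) := by
    ext s
    simp only [Finset.mem_filter, Finset.mem_univ, true_and, Finset.mem_insert, Fin.ext_iff]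
    omega
  rw [partialSum, h, Finset.sum_insert (by simp), add_comm, partialSum]

lemma partialSum_self {n : ℕ} (f : Fin n → ℝ) : partialSum f n = ∑ s, f s := by
  simp [partialSum]

lemma partialSum_congr {n : ℕ} {f g : Fin n → ℝ} {t : ℕ}
    (h : ∀ s : Fin n, (s : ℕ) < t → f s = g s) : partialSum f t = partialSum g t :=
  Finset.sum_congr rfl fun s hs => h s (Finset.mem_filter.1 hs).2

/-- The step of the inductions that bound sums of `1 / r ^ 2` by telescoping. -/
lemma two_div_succ_add_inv_sq_le {r : ℝ} (hr : 1 ≤ r) : 2 / (r + 1) + 1 / r ^ 2 ≤ 2 / r := by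
  have h : 2 / r - (2 / (r + 1) + 1 / r ^ 2) = (r - 1) / (r ^ 2 * (r + 1)) := by
    field_simp; ring
  have : 0 ≤ (r - 1) / (r ^ 2 * (r + 1)) := div_nonneg (by linarith) (by positivity)
  linarith

lemma sum_inv_sq_remaining_le (n : ℕ) : ∑ s : Fin n, 1 / ((n : ℝ) - (s : ℕ)) ^ 2 ≤ 2 := by
  have key : ∀ t ≤ n, partialSum (fun s : Fin n => 1 / ((n : ℝ) - (s : ℕ)) ^ 2) t
      ≤ 2 / ((n : ℝ) - t + 1) := by
    intro t
    induction t with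
    | zero =>
      intro _
      rw [partialSum_zero]
      simp only [Nat.cast_zero, sub_zero]
      positivity
    | succ t ih =>
      intro ht
      have h1 := partialSum_succ (fun s : Fin n => 1 / ((n : ℝ) - (s : ℕ)) ^ 2) ⟨t, ht⟩
      simp only at h1
      have hr : (1 : ℝ) ≤ n - t := by
        have : ((t + 1 : ℕ) : ℝ) ≤ n := by exact_mod_cast ht
        push_cast at this; linarith
      have h2 := two_div_succ_add_inv_sq_le hr
      have h3 := ih (by omega)
      rw [h1]
      push_cast
      rw [show (n : ℝ) - (t + 1) + 1 = n - t by ring]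
      linarith
  have := key n le_rfl
  rwa [partialSum_self, sub_self, zero_add, div_one] at this

lemma sum_inv_remaining_le (n : ℕ) :
    ∑ s : Fin n, 1 / ((n : ℝ) - (s : ℕ)) ≤ 1 + Real.log n := by
  refine le_trans (le_of_eq ?_) (harmonic_le_one_add_log n)
  rw [Fin.sum_univ_eq_sum_range (fun s => 1 / ((n : ℝ) - (s : ℕ))) n, harmonic]
  push_cast
  rw [← Finset.sum_range_reflect]
  refine Finset.sum_congr rfl fun s hs => ?_
  have hs := Finset.mem_range.1 hs
  rw [one_div]
  congr 1
  rw [Nat.cast_sub (by omega), Nat.cast_sub (by omega)]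
  push_cast; ring

/-! ### Independent types -/

/-- `F` depends only on the types of the users that come before time `t`. -/
def DependsOnPast {n K : ℕ} {α : Type*} (t : ℕ) (F : (Fin n → Fin K) → α) : Prop :=
  ∀ κ κ', (∀ s : Fin n, (s : ℕ) < t → κ s = κ' s) → F κ = F κ'

lemma DependsOnPast.update {n K : ℕ} {α : Type*} {t : Fin n} {F : (Fin n → Fin K) → α}
    (h : DependsOnPast (t : ℕ) F) (κ : Fin n → Fin K) (k : Fin K) :
    F (Function.update κ t k) = F κ :=
  h _ _ fun s hs => Function.update_of_ne (by rintro rfl; exact lt_irrefl _ hs) _ _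

namespace FisherMarket

variable {m K : ℕ} {M : FisherMarket m K}

/-- The mean of `F` over sequences of `n` types drawn independently from `M.prob`. -/
noncomputable def pathMean (M : FisherMarket m K) {n : ℕ} (F : (Fin n → Fin K) → ℝ) : ℝ :=
  ∑ κ, (∏ t, M.prob (κ t)) * F κ

section PathMean

variable {n : ℕ} {F G : (Fin n → Fin K) → ℝ}

lemma pathMean_add : M.pathMean (fun κ => F κ + G κ) = M.pathMean F + M.pathMean G := by
  simp_rw [pathMean, mul_add, Finset.sum_add_distrib]

lemma pathMean_sub : M.pathMean (fun κ => F κ - G κ) = M.pathMean F - M.pathMean G := by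
  simp_rw [pathMean, mul_sub, Finset.sum_sub_distrib]

lemma pathMean_const_mul (c : ℝ) : M.pathMean (fun κ => c * F κ) = c * M.pathMean F := by
  simp_rw [pathMean, Finset.mul_sum]
  exact Finset.sum_congr rfl fun κ _ => by ring

lemma pathMean_sum {ι : Type*} (s : Finset ι) (f : ι → (Fin n → Fin K) → ℝ) :
    M.pathMean (fun κ => ∑ i ∈ s, f i κ) = ∑ i ∈ s, M.pathMean (f i) := by
  simp_rw [pathMean, Finset.mul_sum]
  exact Finset.sum_comm

lemma pathMean_const (c : ℝ) : M.pathMean (fun _ : Fin n → Fin K => c) = c := by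
  have h : ∑ κ : Fin n → Fin K, ∏ t, M.prob (κ t) = 1 := by
    have := (Finset.prod_univ_sum (fun _ : Fin n => (Finset.univ : Finset (Fin K)))
      (fun _ k => M.prob k)).symm
    rw [Fintype.piFinset_univ] at this
    rw [this]
    simp [M.prob_sum]
  rw [pathMean, ← Finset.sum_mul, h, one_mul]

/-- Only type sequences of positive probability matter: allocations to types of probability zero
are unbounded. -/
lemma pathMean_mono (h : ∀ κ : Fin n → Fin K, (∀ t, 0 < M.prob (κ t)) → F κ ≤ G κ) :
    M.pathMean F ≤ M.pathMean G := by
  refine Finset.sum_le_sum fun κ _ => ?_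
  by_cases hκ : ∀ t, 0 < M.prob (κ t)
  · exact mul_le_mul_of_nonneg_left (h κ hκ) (Finset.prod_nonneg fun t _ => M.prob_nonneg _)
  · push Not at hκ
    obtain ⟨t, ht⟩ := hκ
    rw [Finset.prod_eq_zero (Finset.mem_univ t) (le_antisymm ht (M.prob_nonneg _))]
    simp

/-- The type of user `t` is independent of the past: averaging over it conditionally on the past
does not change the mean. -/
lemma pathMean_resample (t : Fin n) (φ : (Fin n → Fin K) → Fin K → ℝ)
    (hφ : DependsOnPast (t : ℕ) φ) :
    M.pathMean (fun κ => φ κ (κ t)) = M.pathMean (fun κ => ∑ k, M.prob k * φ κ k) := by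
  have hsplit : ∀ κ : Fin n → Fin K,
      ∏ s, M.prob (κ s) = M.prob (κ t) * ∏ s ∈ Finset.univ.erase t, M.prob (κ s) := fun κ =>
    (Finset.mul_prod_erase _ _ (Finset.mem_univ t)).symm
  have hrest : ∀ (κ : Fin n → Fin K) k,
      ∏ s ∈ Finset.univ.erase t, M.prob (Function.update κ t k s)
        = ∏ s ∈ Finset.univ.erase t, M.prob (κ s) := fun κ k =>
    Finset.prod_congr rfl fun s hs => by
      rw [Function.update_of_ne (Finset.ne_of_mem_erase hs)]
  -- exchanging the type of user `t` with an independent copy is an involution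
  have hswap : ∑ x : (Fin n → Fin K) × Fin K,
        (∏ s, M.prob (x.1 s)) * (M.prob x.2 * φ x.1 x.2)
      = ∑ x : (Fin n → Fin K) × Fin K, (∏ s, M.prob (x.1 s)) * (M.prob x.2 * φ x.1 (x.1 t)) := by
    refine Finset.sum_nbij' (fun x => (Function.update x.1 t x.2, x.1 t))
      (fun x => (Function.update x.1 t x.2, x.1 t)) (by simp) (by simp) (by simp) (by simp) ?_
    rintro ⟨κ, k⟩ _
    simp only [hsplit, hrest, Function.update_self, hφ.update]
    ring
  rw [Fintype.sum_prod_type, Fintype.sum_prod_type] at hswap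
  simp_rw [pathMean, Finset.mul_sum]
  rw [hswap]
  refine Finset.sum_congr rfl fun κ _ => ?_
  dsimp only
  rw [← Finset.mul_sum, ← Finset.sum_mul, M.prob_sum, one_mul]

end PathMean

namespace IsIIDArrivals

variable {Ω : Type*} [MeasurableSpace Ω] {P : Measure Ω} [IsProbabilityMeasure P] {n : ℕ}
  {T : Fin n → Ω → Fin K}

lemma integral_eq_pathMean (hT : M.IsIIDArrivals P T) (F : (Fin n → Fin K) → ℝ) :
    ∫ ω, F (fun t => T t ω) ∂P = M.pathMean F := by
  have hmeas : Measurable (fun ω t => T t ω) := measurable_pi_lambda _ hT.measurable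
  have hmap := integral_map (μ := P) (f := F) hmeas.aemeasurable
    (measurable_of_finite F).aestronglyMeasurable
  have : IsProbabilityMeasure (P.map fun ω t => T t ω) :=
    Measure.isProbabilityMeasure_map hmeas.aemeasurable
  rw [← hmap, integral_fintype .of_finite]
  refine Finset.sum_congr rfl fun κ _ => ?_
  rw [smul_eq_mul]
  congr 1
  rw [map_measureReal_apply hmeas (measurableSet_singleton κ)]
  have hpre : (fun ω t => T t ω) ⁻¹' {κ} = ⋂ t ∈ Finset.univ, T t ⁻¹' {κ t} := by
    ext ω; simp [funext_iff]
  rw [hpre, measureReal_def,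
    hT.indep.measure_inter_preimage_eq_mul Finset.univ fun t _ => measurableSet_singleton (κ t),
    ENNReal.toReal_prod]
  exact Finset.prod_congr rfl fun t _ => hT.law t (κ t)

lemma ae_prob_pos (hT : M.IsIIDArrivals P T) : ∀ᵐ ω ∂P, ∀ t, 0 < M.prob (T t ω) := by
  rw [ae_all_iff]
  intro t
  have h : ∀ k, ∀ᵐ ω ∂P, T t ω = k → 0 < M.prob k := by
    intro k
    rcases (M.prob_nonneg k).eq_or_lt with hk | hk
    · have hnull : P {ω | T t ω = k} = 0 := by
        have := hT.law t k
        rw [← hk] at this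
        exact (measureReal_eq_zero_iff).1 this
      filter_upwards [measure_eq_zero_iff_ae_notMem.1 hnull] with ω hω h
      exact absurd h hω
    · exact Filter.Eventually.of_forall fun _ _ => hk
  filter_upwards [ae_all_iff.2 h] with ω hω using hω _ rfl

end IsIIDArrivals

end FisherMarket

/-! ### Average remaining capacities stopped at the exit from the box -/

section StoppedDeviation

variable {m n : ℕ} (d Δ : Fin m → ℝ) (x : Fin n → Fin m → ℝ)

/-- The average remaining capacities have stayed in the box up to and including time `t`. -/
def InBoxUntil (t : Fin n) : Prop :=
  ∀ s, s ≤ t → avgRemaining d x s ∈ Set.Icc (d - Δ) (d + Δ)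

open Classical in
/-- The change of the average remaining capacity of good `j` caused by user `t`, before the exit
from the box, and `0` afterwards. For the last user the denominator vanishes and the value is `0`;
it is never used. -/
noncomputable def stoppedStep (j : Fin m) (t : Fin n) : ℝ :=
  if InBoxUntil d Δ x t then (pricingCapacity d Δ x t j - x t j) / ((n : ℝ) - (t : ℕ) - 1) else 0

/-- The deviation of the average remaining capacities from `d`, stopped at the first exit from the
box. -/
noncomputable def stoppedDev (t : ℕ) (j : Fin m) : ℝ :=
  partialSum (stoppedStep d Δ x j) t

open Classical in
/-- The indicator of the event that the average remaining capacities have left the box by time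
`t`. -/
noncomputable def outOfBox (t : Fin n) : ℝ := if InBoxUntil d Δ x t then 0 else 1

variable {d Δ x}

lemma pricingCapacity_of_inBoxUntil {t : Fin n} (h : InBoxUntil d Δ x t) :
    pricingCapacity d Δ x t = avgRemaining d x t := if_pos h

lemma pricingCapacity_of_not_inBoxUntil {t : Fin n} (h : ¬InBoxUntil d Δ x t) :
    pricingCapacity d Δ x t = d := if_neg h

lemma stoppedStep_eq (j : Fin m) (t : Fin n) :
    stoppedStep d Δ x j t = (1 - outOfBox d Δ x t) / ((n : ℝ) - (t : ℕ) - 1)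
      * (pricingCapacity d Δ x t j - x t j) := by
  unfold stoppedStep outOfBox
  split_ifs <;> ring

lemma pricingCapacity_mem_Icc (hΔ : ∀ j, 0 < Δ j) (t : Fin n) :
    pricingCapacity d Δ x t ∈ Set.Icc (d - Δ) (d + Δ) := by
  by_cases h : InBoxUntil d Δ x t
  · rw [pricingCapacity_of_inBoxUntil h]; exact h t le_rfl
  · rw [pricingCapacity_of_not_inBoxUntil h]
    exact ⟨fun j => by have := hΔ j; simp only [Pi.sub_apply]; linarith,
      fun j => by have := hΔ j; simp only [Pi.add_apply]; linarith⟩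

section Congr

variable {x' : Fin n → Fin m → ℝ}

lemma avgRemaining_congr {t : Fin n} (h : ∀ s < t, x s = x' s) :
    avgRemaining d x t = avgRemaining d x' t := by
  funext j
  unfold avgRemaining
  congr 2
  exact Finset.sum_congr rfl fun s hs => by rw [h s (Finset.mem_filter.1 hs).2]

lemma inBoxUntil_congr {t : Fin n} (h : ∀ s < t, x s = x' s) :
    InBoxUntil d Δ x t ↔ InBoxUntil d Δ x' t :=
  forall₂_congr fun s hs => by rw [avgRemaining_congr fun r hr => h r (hr.trans_le hs)]

lemma pricingCapacity_congr {t : Fin n} (h : ∀ s < t, x s = x' s) :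
    pricingCapacity d Δ x t = pricingCapacity d Δ x' t := by
  by_cases hb : InBoxUntil d Δ x t
  · rw [pricingCapacity_of_inBoxUntil hb,
      pricingCapacity_of_inBoxUntil ((inBoxUntil_congr h).1 hb), avgRemaining_congr h]
  · rw [pricingCapacity_of_not_inBoxUntil hb,
      pricingCapacity_of_not_inBoxUntil (mt (inBoxUntil_congr h).2 hb)]

lemma outOfBox_congr {t : Fin n} (h : ∀ s < t, x s = x' s) :
    outOfBox d Δ x t = outOfBox d Δ x' t := by
  unfold outOfBox
  by_cases hb : InBoxUntil d Δ x t
  · rw [if_pos hb, if_pos ((inBoxUntil_congr h).1 hb)]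
  · rw [if_neg hb, if_neg (mt (inBoxUntil_congr h).2 hb)]

lemma stoppedDev_congr {t : ℕ} (h : ∀ s : Fin n, (s : ℕ) < t → x s = x' s) (j : Fin m) :
    stoppedDev d Δ x t j = stoppedDev d Δ x' t j := by
  refine partialSum_congr fun s hs => ?_
  have h' : ∀ r < s, x r = x' r := fun r hr => h r ((Fin.lt_def.1 hr).trans hs)
  unfold stoppedStep
  by_cases hb : InBoxUntil d Δ x s
  · rw [if_pos hb, if_pos ((inBoxUntil_congr h').1 hb), pricingCapacity_congr h', h s hs]
  · rw [if_neg hb, if_neg (mt (inBoxUntil_congr h').2 hb)]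

end Congr

lemma avgRemaining_eq_partialSum (t : Fin n) (j : Fin m) :
    avgRemaining d x t j
      = ((n : ℝ) * d j - partialSum (fun s => x s j) t) / ((n : ℝ) - (t : ℕ)) := rfl

lemma avgRemaining_zero (hn : 0 < n) : avgRemaining d x ⟨0, hn⟩ = d := by
  funext j
  have : (n : ℝ) ≠ 0 := by exact_mod_cast hn.ne'
  rw [avgRemaining_eq_partialSum, partialSum_zero]
  simp only [Nat.cast_zero, sub_zero]
  field_simp

lemma avgRemaining_succ {t : ℕ} (ht : t + 1 < n) (j : Fin m) :
    avgRemaining d x ⟨t + 1, ht⟩ j = avgRemaining d x ⟨t, by omega⟩ j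
      + (avgRemaining d x ⟨t, by omega⟩ j - x ⟨t, by omega⟩ j) / ((n : ℝ) - t - 1) := by
  have hr : ((t + 1 : ℕ) : ℝ) < n := by exact_mod_cast ht
  push_cast at hr
  have h1 : (n : ℝ) - t - 1 ≠ 0 := by linarith
  have h2 : (n : ℝ) - t ≠ 0 := by linarith
  have hs := partialSum_succ (fun s => x s j) ⟨t, by omega⟩
  simp only at hs
  rw [avgRemaining_eq_partialSum, avgRemaining_eq_partialSum]
  simp only
  rw [hs]
  push_cast
  rw [show (n : ℝ) - (t + 1) = n - t - 1 by ring]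
  field_simp
  ring

lemma stoppedDev_zero (j : Fin m) : stoppedDev d Δ x 0 j = 0 := partialSum_zero _

lemma stoppedDev_succ (t : Fin n) (j : Fin m) :
    stoppedDev d Δ x ((t : ℕ) + 1) j = stoppedDev d Δ x t j + stoppedStep d Δ x j t :=
  partialSum_succ _ t

lemma InBoxUntil.mono {s t : Fin n} (h : InBoxUntil d Δ x t) (hst : s ≤ t) :
    InBoxUntil d Δ x s := fun r hr => h r (hr.trans hst)

lemma exists_lt_abs_of_notMem_Icc {y : Fin m → ℝ} (h : y ∉ Set.Icc (d - Δ) (d + Δ)) :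
    ∃ j, Δ j < |y j - d j| := by
  by_contra! hno
  refine h ⟨fun j => ?_, fun j => ?_⟩
  · have := (abs_le.1 (hno j)).1
    simp only [Pi.sub_apply]; linarith
  · have := (abs_le.1 (hno j)).2
    simp only [Pi.add_apply]; linarith

/-- Before the exit, the stopped deviation is the true deviation; afterwards it stays at a point
outside of the box. -/
lemma stoppedDev_spec (hΔ : ∀ j, 0 < Δ j) (t : ℕ) (ht : t < n) :
    (InBoxUntil d Δ x ⟨t, ht⟩ → ∀ j, avgRemaining d x ⟨t, ht⟩ j = d j + stoppedDev d Δ x t j) ∧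
      (¬InBoxUntil d Δ x ⟨t, ht⟩ → ∃ j, Δ j < |stoppedDev d Δ x t j|) := by
  induction t with
  | zero =>
    refine ⟨fun _ j => by rw [avgRemaining_zero, stoppedDev_zero, add_zero], fun h => ?_⟩
    refine absurd (fun s hs => ?_) h
    obtain rfl : s = ⟨0, ht⟩ := Fin.ext (Nat.le_zero.1 hs)
    rw [avgRemaining_zero]
    exact ⟨fun j => by have := hΔ j; simp only [Pi.sub_apply]; linarith,
      fun j => by have := hΔ j; simp only [Pi.add_apply]; linarith⟩
  | succ t ih =>
    obtain ⟨ih1, ih2⟩ := ih (by omega)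
    have hsucc := fun j => stoppedDev_succ (d := d) (Δ := Δ) (x := x) ⟨t, by omega⟩ j
    simp only at hsucc
    by_cases hin : InBoxUntil d Δ x ⟨t, by omega⟩
    · have hdev : ∀ j, avgRemaining d x ⟨t + 1, ht⟩ j = d j + stoppedDev d Δ x (t + 1) j := by
        intro j
        rw [hsucc, avgRemaining_succ ht, stoppedStep, if_pos hin,
          pricingCapacity_of_inBoxUntil hin, ih1 hin j]
        ring
      refine ⟨fun _ => hdev, fun hout => ?_⟩
      have hnot : avgRemaining d x ⟨t + 1, ht⟩ ∉ Set.Icc (d - Δ) (d + Δ) := by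
        intro hmem
        refine hout fun s hs => ?_
        rcases (Fin.le_def.1 hs).lt_or_eq with h | h
        · exact hin s (Nat.lt_succ_iff.1 h)
        · obtain rfl : s = ⟨t + 1, ht⟩ := Fin.ext h
          exact hmem
      obtain ⟨j, hj⟩ := exists_lt_abs_of_notMem_Icc hnot
      exact ⟨j, by rwa [hdev, add_sub_cancel_left] at hj⟩
    · refine ⟨fun h => absurd (h.mono (Nat.le_succ t)) hin, fun _ => ?_⟩
      obtain ⟨j, hj⟩ := ih2 hin
      exact ⟨j, by rwa [hsucc, stoppedStep, if_neg hin, add_zero]⟩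

lemma pricingCapacity_eq_add_stoppedDev (hΔ : ∀ j, 0 < Δ j) {t : Fin n}
    (h : InBoxUntil d Δ x t) (j : Fin m) :
    pricingCapacity d Δ x t j = d j + stoppedDev d Δ x t j := by
  rw [pricingCapacity_of_inBoxUntil h]
  exact (stoppedDev_spec hΔ t t.2).1 h j

lemma exists_lt_abs_stoppedDev (hΔ : ∀ j, 0 < Δ j) {t : Fin n} (h : ¬InBoxUntil d Δ x t) :
    ∃ j, Δ j < |stoppedDev d Δ x t j| := (stoppedDev_spec hΔ t t.2).2 h

/-- Chebyshev's inequality in pointwise form, with fourth powers. -/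
lemma outOfBox_le (hΔ : ∀ j, 0 < Δ j) {δ : ℝ} (hδ : 0 < δ) (hδΔ : ∀ j, δ ≤ Δ j) (t : Fin n) :
    outOfBox d Δ x t ≤ (∑ i, stoppedDev d Δ x t i ^ 4) / δ ^ 4 := by
  have hsum : ∀ i ∈ Finset.univ, 0 ≤ stoppedDev d Δ x t i ^ 4 := fun i _ => by positivity
  rw [outOfBox]
  split_ifs with h
  · exact div_nonneg (Finset.sum_nonneg hsum) (by positivity)
  · obtain ⟨i, hi⟩ := exists_lt_abs_stoppedDev hΔ h
    rw [le_div_iff₀ (by positivity), one_mul]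
    refine le_trans ?_ (Finset.single_le_sum hsum (Finset.mem_univ i))
    calc δ ^ 4 ≤ |stoppedDev d Δ x t i| ^ 4 :=
          pow_le_pow_left₀ hδ.le ((hδΔ i).trans hi.le) 4
      _ = _ := (by decide : Even 4).pow_abs _

lemma outOfBox_mul_abs_le (hΔ : ∀ j, 0 < Δ j) {δ : ℝ} (hδ : 0 < δ) (hδΔ : ∀ j, δ ≤ Δ j)
    (t : Fin n) (j : Fin m) :
    outOfBox d Δ x t * |stoppedDev d Δ x t j|
      ≤ 2 * (∑ i, stoppedDev d Δ x t i ^ 4) / δ ^ 3 := by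
  have hsum : ∀ i ∈ Finset.univ, 0 ≤ stoppedDev d Δ x t i ^ 4 := fun i _ => by positivity
  have hout := outOfBox_le (d := d) (x := x) hΔ hδ hδΔ t
  have hj := Finset.single_le_sum hsum (Finset.mem_univ j)
  rw [le_div_iff₀ (by positivity)] at hout ⊢
  have h01 : outOfBox d Δ x t = 0 ∨ outOfBox d Δ x t = 1 := by
    unfold outOfBox; split_ifs <;> simp
  rcases h01 with h | h
  · rw [h]; have := Finset.sum_nonneg hsum; linarith
  rw [h, one_mul] at hout ⊢
  rw [← (by decide : Even 4).pow_abs (stoppedDev d Δ x t j)] at hj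
  set a := |stoppedDev d Δ x t j| with ha
  have ha0 : 0 ≤ a := abs_nonneg _
  have hS := Finset.sum_nonneg hsum
  rcases le_total a δ with hle | hle
  · nlinarith [mul_le_mul_of_nonneg_right hle (pow_nonneg hδ.le 3)]
  · nlinarith [mul_le_mul_of_nonneg_left (pow_le_pow_left₀ hδ.le hle 3) ha0]

/-- The total excess demand splits into the excess after the exit, whose increments have mean zero,
and the excess at the exit. The latter is minus the deviation at the exit times the number of
remaining users, that is, minus the sum of the frozen deviation over all times after the exit.
`B` accounts for the last user, who may be served in the box. -/
lemma abs_sum_sub_le_of_stoppedDev (hΔ : ∀ j, 0 < Δ j) (hn : 0 < n) (j : Fin m) {B : ℝ}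
    (hB : ∀ t, |pricingCapacity d Δ x t j - x t j| ≤ B) :
    |∑ t, x t j - (n : ℝ) * d j|
      ≤ |∑ t, outOfBox d Δ x t * (pricingCapacity d Δ x t j - x t j)|
        + ∑ t : Fin n, outOfBox d Δ x t * |stoppedDev d Δ x t j| + B := by
  set Z : Fin n → ℝ := fun t => outOfBox d Δ x t * (pricingCapacity d Δ x t j - x t j) with hZ
  set Q : Fin n → ℝ := fun t => outOfBox d Δ x t * stoppedDev d Δ x t j with hQ
  set Y : Fin n → ℝ := fun t => x t j - d j with hY
  have hin : ∀ t, InBoxUntil d Δ x t → Z t = 0 ∧ Q t = 0 := fun t h => by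
    simp [hZ, hQ, outOfBox, h]
  have hout : ∀ t, ¬InBoxUntil d Δ x t → Z t = d j - x t j ∧ Q t = stoppedDev d Δ x t j :=
    fun t h => by
      simp [hZ, hQ, outOfBox, h, pricingCapacity_of_not_inBoxUntil h]
  -- Abel summation; in the box `η (t + 1) = η t + (d + η t - x t) / (n - t - 1)` for the stopped
  -- deviation `η`
  have key : ∀ t < n, partialSum Y t
      = -partialSum Z t - partialSum Q t - ((n : ℝ) - t) * stoppedDev d Δ x t j := by
    intro t
    induction t with
    | zero => intro _; simp [partialSum_zero, stoppedDev_zero]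
    | succ t ih =>
      intro ht
      have ih := ih (by omega)
      have hr : ((t + 1 : ℕ) : ℝ) < n := by exact_mod_cast ht
      push_cast at hr
      have h1 : (n : ℝ) - t - 1 ≠ 0 := by linarith
      have sY := partialSum_succ Y ⟨t, by omega⟩
      have sZ := partialSum_succ Z ⟨t, by omega⟩
      have sQ := partialSum_succ Q ⟨t, by omega⟩
      have sD := stoppedDev_succ (d := d) (Δ := Δ) (x := x) ⟨t, by omega⟩ j
      simp only at sY sZ sQ sD
      rw [sY, sZ, sQ, sD, ih]
      push_cast
      by_cases h : InBoxUntil d Δ x ⟨t, by omega⟩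
      · have hb := pricingCapacity_eq_add_stoppedDev hΔ h j
        rw [(hin _ h).1, (hin _ h).2, stoppedStep, if_pos h, hb]
        simp only [hY]
        field_simp
        ring
      · rw [(hout _ h).1, (hout _ h).2, stoppedStep, if_neg h]
        simp only [hY]
        ring
  obtain ⟨N, rfl⟩ : ∃ N, n = N + 1 := ⟨n - 1, by omega⟩
  have hlast := key N (Nat.lt_succ_self N)
  have sY := partialSum_succ Y (Fin.last N)
  have sZ := partialSum_succ Z (Fin.last N)
  have sQ := partialSum_succ Q (Fin.last N)
  simp only [Fin.val_last] at sY sZ sQ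
  rw [partialSum_self] at sY sZ sQ
  have hsumY : ∑ t, Y t = ∑ t, x t j - ((N + 1 : ℕ) : ℝ) * d j := by
    simp [hY, Finset.sum_sub_distrib]
  have hQabs : |∑ t, Q t| ≤ ∑ t : Fin (N + 1), outOfBox d Δ x t * |stoppedDev d Δ x t j| := by
    refine (Finset.abs_sum_le_sum_abs _ _).trans (Finset.sum_le_sum fun t _ => ?_)
    have : 0 ≤ outOfBox d Δ x t := by unfold outOfBox; split_ifs <;> norm_num
    rw [hQ, abs_mul, abs_of_nonneg this]
  -- the recursion for the deviation is void for the last user, who is treated separately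
  have herr : |∑ t, Y t + ∑ t, Z t + ∑ t, Q t| ≤ B := by
    have hBN := hB (Fin.last N)
    rw [sY, sZ, sQ, hlast]
    push_cast
    by_cases h : InBoxUntil d Δ x (Fin.last N)
    · have hb := pricingCapacity_eq_add_stoppedDev hΔ h j
      rw [(hin _ h).1, (hin _ h).2]
      rw [abs_sub_comm, hb] at hBN
      simp only [hY, Fin.val_last] at hBN ⊢
      convert hBN using 2
      ring
    · rw [(hout _ h).1, (hout _ h).2]
      refine le_trans (le_of_eq ?_) ((abs_nonneg _).trans hBN)
      simp only [hY, Fin.val_last]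
      rw [abs_eq_zero]
      ring
  rw [← hsumY]
  have h3 : ∑ t, Y t = (∑ t, Y t + ∑ t, Z t + ∑ t, Q t) - ∑ t, Z t - ∑ t, Q t := by ring
  have h4 := abs_sub ((∑ t, Y t + ∑ t, Z t + ∑ t, Q t) - ∑ t, Z t) (∑ t, Q t)
  have h5 := abs_sub (∑ t, Y t + ∑ t, Z t + ∑ t, Q t) (∑ t, Z t)
  rw [h3]
  linarith

lemma violation_le_sum (d : Fin m → ℝ) (x : Fin n → Fin m → ℝ) :
    violation d x ≤ ∑ j, |∑ t, x t j - (n : ℝ) * d j| := by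
  have h0 : ∀ j ∈ Finset.univ, 0 ≤ |∑ t, x t j - (n : ℝ) * d j| := fun j _ => abs_nonneg _
  rw [violation, EuclideanSpace.norm_eq]
  refine Real.sqrt_le_iff.2 ⟨Finset.sum_nonneg h0, ?_⟩
  refine le_trans (Finset.sum_le_sum fun j _ => ?_) (Finset.sum_sq_le_sq_sum_of_nonneg h0)
  rw [Real.norm_eq_abs, sq_abs, sq_abs]
  refine (sq_le_sq.2 ?_).trans (sq_abs _).le
  rw [abs_abs]
  rcases max_cases (∑ t, x t j - (n : ℝ) * d j) 0 with h | h
  · simp [h.1]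
  · simp [h.1]

end StoppedDeviation

/-! ### Moments of the stopped deviation -/

namespace FisherMarket

variable {m K : ℕ} {M : FisherMarket m K}

/-- Second and fourth moments of a martingale whose increment at time `t` is at most
`B / (n - t - 1)`. Of the martingale property only the orthogonality of the increment to the powers
of the present value is used. The constants `2` and `15` make both inductions close for every
`r = n - t - 1 ≥ 1`. -/
theorem pathMean_martingale_moments {n : ℕ} {B : ℝ} {η : ℕ → (Fin n → Fin K) → ℝ}
    {ξ : Fin n → (Fin n → Fin K) → ℝ} (hzero : ∀ κ, η 0 κ = 0)
    (hsucc : ∀ (t : Fin n) κ, η ((t : ℕ) + 1) κ = η t κ + ξ t κ)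
    (hmart : ∀ (t : Fin n) (i : ℕ), M.pathMean (fun κ => η t κ ^ i * ξ t κ) = 0)
    (hbound : ∀ (t : Fin n), (t : ℕ) + 1 < n → ∀ κ, (∀ s, 0 < M.prob (κ s)) →
      |ξ t κ| ≤ B / ((n : ℝ) - (t : ℕ) - 1)) (t : ℕ) (ht : t < n) :
    M.pathMean (fun κ => η t κ ^ 2) ≤ 2 * B ^ 2 / ((n : ℝ) - t) ∧
      M.pathMean (fun κ => η t κ ^ 4) ≤ 15 * B ^ 4 / ((n : ℝ) - t) ^ 2 := by
  induction t with
  | zero =>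
    simp only [hzero]
    rw [pathMean_const, pathMean_const]
    simp only [Nat.cast_zero, sub_zero]
    constructor <;> norm_num <;> positivity
  | succ t ih =>
    obtain ⟨ih2, ih4⟩ := ih (by omega)
    have hs := hsucc ⟨t, by omega⟩
    have hm := hmart ⟨t, by omega⟩
    have hb := hbound ⟨t, by omega⟩ ht
    set X : (Fin n → Fin K) → ℝ := ξ ⟨t, by omega⟩ with hX
    simp only at hs hm hb
    have hr : (1 : ℝ) ≤ (n : ℝ) - t - 1 := by
      have h1 : ((t + 1 + 1 : ℕ) : ℝ) ≤ n := by exact_mod_cast ht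
      push_cast at h1; linarith
    push_cast
    rw [show (n : ℝ) - (t + 1) = n - t - 1 by ring]
    set r : ℝ := (n : ℝ) - t - 1 with hrdef
    rw [show (n : ℝ) - t = r + 1 by rw [hrdef]; ring] at ih2 ih4
    have hr0 : 0 < r := by linarith
    have hsq : ∀ κ, (∀ s, 0 < M.prob (κ s)) → X κ ^ 2 ≤ B ^ 2 / r ^ 2 := by
      intro κ hκ
      rw [← div_pow, ← sq_abs]
      exact pow_le_pow_left₀ (abs_nonneg _) (hb κ hκ) 2
    have hm1 := hm 1
    have hm3 := hm 3
    constructor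
    · have h1 : M.pathMean (fun κ => η (t + 1) κ ^ 2)
          ≤ M.pathMean (fun κ => (η t κ ^ 2 + 2 * (η t κ ^ 1 * X κ)) + B ^ 2 / r ^ 2) :=
        pathMean_mono fun κ hκ => by rw [hs]; nlinarith [hsq κ hκ]
      rw [pathMean_add, pathMean_add, pathMean_const_mul, pathMean_const, hm1] at h1
      have h2 := mul_le_mul_of_nonneg_left (two_div_succ_add_inv_sq_le hr) (sq_nonneg B)
      calc _ ≤ _ := h1
        _ ≤ B ^ 2 * (2 / (r + 1) + 1 / r ^ 2) := by
          have : B ^ 2 * (2 / (r + 1) + 1 / r ^ 2)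
            = 2 * B ^ 2 / (r + 1) + B ^ 2 / r ^ 2 := by ring
          linarith
        _ ≤ _ := h2
        _ = _ := by ring
    · set c : ℝ := B ^ 2 / r ^ 2 with hc
      have h1 : M.pathMean (fun κ => η (t + 1) κ ^ 4)
          ≤ M.pathMean (fun κ => ((η t κ ^ 4 + 4 * (η t κ ^ 3 * X κ)) + 8 * c * η t κ ^ 2)
            + 3 * c ^ 2) := by
        refine pathMean_mono fun κ hκ => ?_
        have hx := hsq κ hκ
        have hx2 : (X κ ^ 2) ^ 2 ≤ c ^ 2 := pow_le_pow_left₀ (sq_nonneg _) hx 2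
        have hmul := mul_le_mul_of_nonneg_left hx (sq_nonneg (η t κ))
        -- the third-order term is absorbed by the second- and fourth-order ones
        have hcross : 4 * η t κ * X κ ^ 3 ≤ 2 * η t κ ^ 2 * X κ ^ 2 + 2 * (X κ ^ 2) ^ 2 := by
          nlinarith [mul_nonneg (sq_nonneg (X κ)) (sq_nonneg (η t κ - X κ))]
        have hexp : (η t κ + X κ) ^ 4 = η t κ ^ 4 + 4 * (η t κ ^ 3 * X κ)
          + 6 * (η t κ ^ 2 * X κ ^ 2) + 4 * η t κ * X κ ^ 3 + (X κ ^ 2) ^ 2 := by ring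
        rw [hs, hexp]
        nlinarith
      rw [pathMean_add, pathMean_add, pathMean_add, pathMean_const_mul, pathMean_const_mul,
        pathMean_const, hm3] at h1
      have hc0 : 0 ≤ c := by positivity
      have h2 := mul_le_mul_of_nonneg_left ih2 (mul_nonneg (by norm_num : (0 : ℝ) ≤ 8) hc0)
      have h3 : 15 * B ^ 4 / r ^ 2
          - (15 * B ^ 4 / (r + 1) ^ 2 + 8 * c * (2 * B ^ 2 / (r + 1)) + 3 * c ^ 2)
          = B ^ 4 * (14 * r ^ 3 - 4 * r ^ 2 - 6 * r - 3) / (r ^ 4 * (r + 1) ^ 2) := by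
        rw [hc]; field_simp; ring
      have h4 : 0 ≤ B ^ 4 * (14 * r ^ 3 - 4 * r ^ 2 - 6 * r - 3) / (r ^ 4 * (r + 1) ^ 2) := by
        refine div_nonneg (mul_nonneg (by positivity) ?_) (by positivity)
        nlinarith [mul_nonneg (sub_nonneg.2 hr) hr0.le,
          mul_nonneg (mul_nonneg (sub_nonneg.2 hr) hr0.le) hr0.le]
      linarith

end FisherMarket

/-! ### Expected constraint violation -/

namespace FisherMarket

variable {m K : ℕ} {M : FisherMarket m K}

namespace IsAdaptivePricing

variable {d Δ : Fin m → ℝ} {n : ℕ} {price : (Fin n → Fin K) → Fin n → Fin m → ℝ}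
  {plan : (Fin n → Fin K) → Fin n → Fin K → Fin m → ℝ}

lemma consumption_eq (hA : M.IsAdaptivePricing d Δ price plan) {κ κ' : Fin n → Fin K} {t : ℕ}
    (h : ∀ s : Fin n, (s : ℕ) < t → κ s = κ' s) (s : Fin n) (hs : (s : ℕ) < t) :
    consumption plan κ s = consumption plan κ' s := by
  unfold consumption
  rw [hA.plan_nonanticipating κ κ' s fun r hr => h r ((Fin.lt_def.1 hr).trans hs), h s hs]

lemma isEquilibrium (hA : M.IsAdaptivePricing d Δ price plan) (hbuyers : M.AllGoodsHaveBuyers)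
    (hΔ : ∀ j, 0 < Δ j ∧ Δ j < d j) (κ : Fin n → Fin K) (t : Fin n) :
    M.IsEquilibrium (pricingCapacity d Δ (consumption plan κ) t) (price κ t) (plan κ t) := by
  refine (hA.plan_optimal κ t).isEquilibrium hbuyers (fun j => ?_) (hA.price_dual κ t)
  have := (pricingCapacity_mem_Icc (d := d) (x := consumption plan κ) (fun j => (hΔ j).1) t).1 j
  simp only [Pi.sub_apply] at this
  linarith [(hΔ j).2]

/-- Capacities are used up in the certainty equivalent problem, so that the expected consumption of
user `t`, conditionally on the past, is the capacity for which the problem was solved. -/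
lemma pathMean_mul_sub_consumption (hA : M.IsAdaptivePricing d Δ price plan)
    (hbuyers : M.AllGoodsHaveBuyers) (hΔ : ∀ j, 0 < Δ j ∧ Δ j < d j) (t : Fin n) (j : Fin m)
    {F : (Fin n → Fin K) → ℝ} (hF : DependsOnPast (t : ℕ) F) :
    M.pathMean (fun κ => F κ * (pricingCapacity d Δ (consumption plan κ) t j
      - consumption plan κ t j)) = 0 := by
  have h := pathMean_resample (M := M) t (fun κ k => F κ *
    (pricingCapacity d Δ (consumption plan κ) t j - plan κ t k j)) fun κ κ' hκ => by
      funext k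
      dsimp only
      rw [hF κ κ' hκ, hA.plan_nonanticipating κ κ' t hκ,
        pricingCapacity_congr fun s hs => hA.consumption_eq hκ s hs]
  refine h.trans ?_
  rw [← pathMean_const (M := M) (n := n) 0]
  congr 1
  funext κ
  have hc := (hA.isEquilibrium hbuyers hΔ κ t).clears j
  have hsplit : ∑ k, M.prob k * (F κ * (pricingCapacity d Δ (consumption plan κ) t j
        - plan κ t k j))
      = F κ * ((∑ k, M.prob k) * pricingCapacity d Δ (consumption plan κ) t j
        - ∑ k, plan κ t k j * M.prob k) := by
    rw [Finset.sum_mul, ← Finset.sum_sub_distrib, Finset.mul_sum]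
    exact Finset.sum_congr rfl fun k _ => by ring
  rw [hsplit, hc, M.prob_sum]
  ring

lemma pathMean_pow_mul_stoppedStep (hA : M.IsAdaptivePricing d Δ price plan)
    (hbuyers : M.AllGoodsHaveBuyers) (hΔ : ∀ j, 0 < Δ j ∧ Δ j < d j) (t : Fin n) (j : Fin m)
    (i : ℕ) : M.pathMean (fun κ => stoppedDev d Δ (consumption plan κ) t j ^ i *
      stoppedStep d Δ (consumption plan κ) j t) = 0 := by
  simp_rw [stoppedStep_eq, ← mul_assoc]
  refine hA.pathMean_mul_sub_consumption hbuyers hΔ t j fun κ κ' h => ?_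
  rw [stoppedDev_congr (hA.consumption_eq h) j,
    outOfBox_congr fun s hs => hA.consumption_eq h s hs]

lemma pathMean_stoppedDev (hA : M.IsAdaptivePricing d Δ price plan)
    (hbuyers : M.AllGoodsHaveBuyers) (hΔ : ∀ j, 0 < Δ j ∧ Δ j < d j) (j : Fin m) (t : ℕ)
    (ht : t ≤ n) : M.pathMean (fun κ => stoppedDev d Δ (consumption plan κ) t j) = 0 := by
  induction t with
  | zero => simp_rw [stoppedDev_zero]; exact pathMean_const 0
  | succ t ih =>
    have h := fun κ => stoppedDev_succ (d := d) (Δ := Δ) (x := consumption plan κ) ⟨t, ht⟩ j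
    have h0 := hA.pathMean_pow_mul_stoppedStep hbuyers hΔ ⟨t, ht⟩ j 0
    simp only [pow_zero, one_mul] at h h0
    simp_rw [h]
    rw [pathMean_add, ih (by omega), h0, add_zero]

theorem pathMean_stoppedDev_pow_le (hA : M.IsAdaptivePricing d Δ price plan)
    (hbuyers : M.AllGoodsHaveBuyers) (hΔ : ∀ j, 0 < Δ j ∧ Δ j < d j) {B : ℝ}
    (hB : ∀ κ : Fin n → Fin K, (∀ s, 0 < M.prob (κ s)) → ∀ t j,
      |pricingCapacity d Δ (consumption plan κ) t j - consumption plan κ t j| ≤ B)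
    (t : Fin n) (j : Fin m) :
    M.pathMean (fun κ => stoppedDev d Δ (consumption plan κ) t j ^ 2)
        ≤ 2 * B ^ 2 / ((n : ℝ) - (t : ℕ)) ∧
      M.pathMean (fun κ => stoppedDev d Δ (consumption plan κ) t j ^ 4)
        ≤ 15 * B ^ 4 / ((n : ℝ) - (t : ℕ)) ^ 2 := by
  refine pathMean_martingale_moments (M := M) (B := B)
    (η := fun t κ => stoppedDev d Δ (consumption plan κ) t j)
    (ξ := fun t κ => stoppedStep d Δ (consumption plan κ) j t)
    (fun κ => stoppedDev_zero j) (fun t κ => stoppedDev_succ t j)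
    (fun t i => hA.pathMean_pow_mul_stoppedStep hbuyers hΔ t j i)
    (fun t ht κ hκ => ?_) t t.2
  have hr : ((t + 1 : ℕ) : ℝ) < n := by exact_mod_cast ht
  push_cast at hr
  have hr : (0 : ℝ) < (n : ℝ) - (t : ℕ) - 1 := by linarith
  have hb := hB κ hκ t j
  unfold stoppedStep
  split_ifs
  · rw [abs_div, abs_of_pos hr]
    exact div_le_div_of_nonneg_right hb hr.le
  · rw [abs_zero]
    exact div_nonneg ((abs_nonneg _).trans hb) hr.le

/-- The exit from the box has probability of order `1 / (n - t) ^ 2` at time `t`, by the fourth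
moment; this is summable, which keeps both parts of the excess demand bounded. -/
theorem pathMean_violation_le (hA : M.IsAdaptivePricing d Δ price plan)
    (hbuyers : M.AllGoodsHaveBuyers) (hΔ : ∀ j, 0 < Δ j ∧ Δ j < d j) (hn : 0 < n) {B δ : ℝ}
    (hB : ∀ κ : Fin n → Fin K, (∀ s, 0 < M.prob (κ s)) → ∀ t j,
      |pricingCapacity d Δ (consumption plan κ) t j - consumption plan κ t j| ≤ B)
    (hδ : 0 < δ) (hδΔ : ∀ j, δ ≤ Δ j) :
    M.pathMean (fun κ => violation d (consumption plan κ))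
      ≤ m * (1 + B + 30 * m * B ^ 4 * (B ^ 2 / δ ^ 4 + 2 / δ ^ 3)) := by
  have hΔ0 : ∀ j, 0 < Δ j := fun j => (hΔ j).1
  set S : Fin n → (Fin n → Fin K) → ℝ :=
    fun t κ => ∑ i, stoppedDev d Δ (consumption plan κ) t i ^ 4 with hS
  have hmean : ∑ t, M.pathMean (S t) ≤ 30 * m * B ^ 4 := by
    have h1 : ∀ t : Fin n, M.pathMean (S t) ≤ m * (15 * B ^ 4) * (1 / ((n : ℝ) - (t : ℕ)) ^ 2) := by
      intro t
      rw [hS, pathMean_sum]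
      refine (Finset.sum_le_sum fun i _ =>
        (hA.pathMean_stoppedDev_pow_le hbuyers hΔ hB t i).2).trans (le_of_eq ?_)
      simp; ring
    refine (Finset.sum_le_sum fun t _ => h1 t).trans ?_
    rw [← Finset.mul_sum]
    have := mul_le_mul_of_nonneg_left (sum_inv_sq_remaining_le n)
      (show 0 ≤ m * (15 * B ^ 4) by positivity)
    linarith
  set ζ : Fin m → Fin n → (Fin n → Fin K) → ℝ := fun j t κ =>
    outOfBox d Δ (consumption plan κ) t *
      (pricingCapacity d Δ (consumption plan κ) t j - consumption plan κ t j) with hζ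
  -- the excess after the exit is a martingale with increments bounded by `B` times the indicator
  have hZ : ∀ j, ∀ t ≤ n, M.pathMean (fun κ => partialSum (fun s => ζ j s κ) t ^ 2)
      ≤ partialSum (fun s => B ^ 2 / δ ^ 4 * M.pathMean (S s)) t := by
    intro j t
    induction t with
    | zero =>
      intro _
      simp_rw [partialSum_zero]
      rw [pathMean_const]; norm_num
    | succ t ih =>
      intro ht
      have h1 := fun κ => partialSum_succ (fun s => ζ j s κ) ⟨t, ht⟩
      have h2 := partialSum_succ (fun s => B ^ 2 / δ ^ 4 * M.pathMean (S s)) ⟨t, ht⟩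
      simp only at h1 h2
      simp_rw [h1]
      rw [h2]
      have hcross : M.pathMean (fun κ => partialSum (fun s => ζ j s κ) t * ζ j ⟨t, ht⟩ κ) = 0 := by
        simp_rw [hζ, ← mul_assoc]
        refine hA.pathMean_mul_sub_consumption hbuyers hΔ ⟨t, ht⟩ j fun κ κ' h => ?_
        rw [outOfBox_congr fun s hs => hA.consumption_eq h s hs]
        congr 1
        refine partialSum_congr fun s hs => ?_
        have hx := hA.consumption_eq h
        have hx' : ∀ r < s, consumption plan κ r = consumption plan κ' r := fun r hr =>
          hx r ((Fin.lt_def.1 hr).trans hs)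
        rw [outOfBox_congr hx', pricingCapacity_congr hx', hx s hs]
      have hstep : M.pathMean (fun κ => (partialSum (fun s => ζ j s κ) t + ζ j ⟨t, ht⟩ κ) ^ 2)
          ≤ M.pathMean (fun κ => (partialSum (fun s => ζ j s κ) t ^ 2
            + 2 * (partialSum (fun s => ζ j s κ) t * ζ j ⟨t, ht⟩ κ))
            + B ^ 2 / δ ^ 4 * S ⟨t, ht⟩ κ) := by
        refine pathMean_mono fun κ hκ => ?_
        have hout := outOfBox_le (d := d) (x := consumption plan κ) hΔ0 hδ hδΔ ⟨t, ht⟩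
        have hb : (pricingCapacity d Δ (consumption plan κ) ⟨t, ht⟩ j
            - consumption plan κ ⟨t, ht⟩ j) ^ 2 ≤ B ^ 2 := by
          rw [← sq_abs]
          exact pow_le_pow_left₀ (abs_nonneg _) (hB κ hκ _ j) 2
        have hsq : outOfBox d Δ (consumption plan κ) ⟨t, ht⟩ ^ 2
            = outOfBox d Δ (consumption plan κ) ⟨t, ht⟩ := by
          unfold outOfBox; split_ifs <;> norm_num
        have hnn : 0 ≤ outOfBox d Δ (consumption plan κ) ⟨t, ht⟩ := by
          unfold outOfBox; split_ifs <;> norm_num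
        have hζsq : ζ j ⟨t, ht⟩ κ ^ 2 ≤ B ^ 2 / δ ^ 4 * S ⟨t, ht⟩ κ := by
          calc ζ j ⟨t, ht⟩ κ ^ 2
              ≤ outOfBox d Δ (consumption plan κ) ⟨t, ht⟩ * B ^ 2 := by
                rw [hζ, mul_pow, hsq]; exact mul_le_mul_of_nonneg_left hb hnn
            _ ≤ S ⟨t, ht⟩ κ / δ ^ 4 * B ^ 2 := mul_le_mul_of_nonneg_right hout (sq_nonneg B)
            _ = _ := by ring
        nlinarith
      rw [pathMean_add, pathMean_add, pathMean_const_mul, hcross, pathMean_const_mul] at hstep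
      linarith [ih (by omega)]
  have hcoord : ∀ j, M.pathMean (fun κ => |∑ t, consumption plan κ t j - (n : ℝ) * d j|)
      ≤ 1 + B + 30 * m * B ^ 4 * (B ^ 2 / δ ^ 4 + 2 / δ ^ 3) := by
    intro j
    have h1 : M.pathMean (fun κ => |∑ t, consumption plan κ t j - (n : ℝ) * d j|)
        ≤ M.pathMean (fun κ => ((1 + B) + partialSum (fun s => ζ j s κ) n ^ 2)
          + ∑ t, 2 / δ ^ 3 * S t κ) := by
      refine pathMean_mono fun κ hκ => ?_
      have h2 := abs_sum_sub_le_of_stoppedDev (x := consumption plan κ) hΔ0 hn j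
        fun t => hB κ hκ t j
      have h3 : ∑ t : Fin n, outOfBox d Δ (consumption plan κ) t *
          |stoppedDev d Δ (consumption plan κ) t j| ≤ ∑ t, 2 / δ ^ 3 * S t κ :=
        Finset.sum_le_sum fun t _ =>
          (outOfBox_mul_abs_le hΔ0 hδ hδΔ t j).trans (le_of_eq (by rw [hS]; ring))
      rw [partialSum_self]
      set z := ∑ t, ζ j t κ with hz
      have h4 : |z| ≤ 1 + z ^ 2 := by
        rw [← sq_abs]; nlinarith [sq_nonneg (|z| - 1), abs_nonneg z]
      linarith
    have h5 := hZ j n le_rfl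
    rw [partialSum_self, ← Finset.mul_sum] at h5
    rw [pathMean_add, pathMean_add, pathMean_const, pathMean_sum] at h1
    simp_rw [pathMean_const_mul] at h1
    rw [← Finset.mul_sum] at h1
    have h6 := mul_le_mul_of_nonneg_left hmean
      (show 0 ≤ B ^ 2 / δ ^ 4 + 2 / δ ^ 3 by positivity)
    linarith
  refine (pathMean_mono fun κ _ => violation_le_sum d (consumption plan κ)).trans ?_
  rw [pathMean_sum]
  refine (Finset.sum_le_sum fun j _ => hcoord j).trans (le_of_eq ?_)
  rw [Finset.sum_const, Finset.card_univ, Fintype.card_fin, nsmul_eq_mul]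

end IsAdaptivePricing

end FisherMarket

/-! ### Uniform bounds and expected regret -/

lemma exists_pos_forall_le {ι : Type*} [Finite ι] (f : ι → ℝ) : ∃ C, 0 < C ∧ ∀ i, f i ≤ C := by
  obtain ⟨C, hC⟩ := (Set.finite_range f).bddAbove
  exact ⟨max C 1, by positivity, fun i => (hC ⟨i, rfl⟩).trans (le_max_left _ _)⟩

lemma exists_pos_forall_ge {ι : Type*} [Finite ι] (f : ι → ℝ) (hf : ∀ i, 0 < f i) :
    ∃ c, 0 < c ∧ ∀ i, c ≤ f i := by
  obtain ⟨C, hC, h⟩ := exists_pos_forall_le fun i => (f i)⁻¹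
  exact ⟨C⁻¹, inv_pos.2 hC, fun i => inv_le_of_inv_le₀ (hf i) (h i)⟩

namespace FisherMarket

variable {m K : ℕ} {M : FisherMarket m K}

/-- Bounds on prices and allocations that hold uniformly for capacities in the box. -/
lemma exists_equilibrium_bounds (hbuyers : M.AllGoodsHaveBuyers) {d Δ : Fin m → ℝ}
    (hΔ : ∀ j, 0 < Δ j ∧ Δ j < d j) :
    ∃ l u B : ℝ, 0 < l ∧ 0 < u ∧ ∀ b ∈ Set.Icc (d - Δ) (d + Δ), ∀ p z,
      M.IsEquilibrium b p z → (∀ j, l ≤ p j ∧ p j ≤ u) ∧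
        ∀ k, 0 < M.prob k → ∀ j, |b j - z k j| ≤ B := by
  have hd : ∀ j, 0 < (d + Δ) j := fun j => add_pos ((hΔ j).1.trans (hΔ j).2) (hΔ j).1
  choose buyer hbuyer hbuyer' using hbuyers.exists_buyer
  obtain ⟨l, hl, hl'⟩ := exists_pos_forall_ge
    (fun j => M.budget (buyer j) * M.util (buyer j) j
      / M.utility (buyer j) (fun i => (d + Δ) i / M.prob (buyer j))) fun j => by
    refine div_pos (mul_pos (M.budget_pos _) (hbuyer' j)) ?_
    refine Finset.sum_pos' (fun i _ => ?_) ⟨j, Finset.mem_univ j, ?_⟩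
    · exact mul_nonneg (M.util_nonneg _ _) (div_pos (hd i) (hbuyer j)).le
    · exact mul_pos (hbuyer' j) (div_pos (hd j) (hbuyer j))
  obtain ⟨u, hu, hu'⟩ := exists_pos_forall_le
    fun j => (∑ k, M.prob k * M.budget k) / (d j - Δ j)
  obtain ⟨B, hB, hB'⟩ := exists_pos_forall_le
    fun x : Fin K × Fin m => (d + Δ) x.2 + (d + Δ) x.2 / M.prob x.1
  refine ⟨l, u, B, hl, hu, fun b hb p z h => ⟨fun j => ⟨?_, ?_⟩, fun k hk j => ?_⟩⟩
  · exact (hl' j).trans (h.le_price (hbuyer j) hb.2)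
  · have hbj : d j - Δ j ≤ b j := hb.1 j
    have hpos : 0 < d j - Δ j := sub_pos.2 (hΔ j).2
    refine (h.price_le (hpos.trans_le hbj)).trans (le_trans ?_ (hu' j))
    refine div_le_div_of_nonneg_left ?_ hpos hbj
    exact Finset.sum_nonneg fun k _ => mul_nonneg (M.prob_nonneg k) (M.budget_pos k).le
  · have h1 := h.allocation_le hk j
    have h2 := div_le_div_of_nonneg_right (hb.2 j) hk.le
    have h3 := hB' (k, j)
    have h4 := h.nonneg k j
    have h5 := h.capacity_nonneg j
    have h6 := div_pos (hd j) hk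
    have h7 := hb.2 j
    simp only at h3
    exact abs_le.2 ⟨by linarith [hd j], by linarith⟩

lemma utility_pos_of_pos (hutil : ∀ k, 0 < M.prob k → ∃ j, 0 < M.util k j) {k : Fin K}
    (hk : 0 < M.prob k) {x : Fin m → ℝ} (hx : ∀ j, 0 < x j) : 0 < M.utility k x := by
  obtain ⟨j, hj⟩ := hutil k hk
  exact Finset.sum_pos' (fun i _ => mul_nonneg (M.util_nonneg k i) (hx i).le)
    ⟨j, Finset.mem_univ j, mul_pos hj (hx j)⟩

/-- Weak duality for the offline problem, with the equilibrium prices at capacities `d`. The types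
along `κ` are required to have positive probability since otherwise the feasible set may be empty,
and the optimal value the junk value of `sSup`. -/
lemma IsEquilibrium.offlineOptimum_le {d p : Fin m → ℝ} {z : Fin K → Fin m → ℝ}
    (h : M.IsEquilibrium d p z) (hutil : ∀ k, 0 < M.prob k → ∃ j, 0 < M.util k j)
    (hd : ∀ j, 0 < d j) {n : ℕ} {κ : Fin n → Fin K} (hκ : ∀ t, 0 < M.prob (κ t)) :
    M.offlineOptimum d κ ≤ ∑ t, (M.budget (κ t) * Real.log (M.utility (κ t) (z (κ t)))
      - M.budget (κ t) + ∑ j, p j * d j) := by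
  refine csSup_le (Set.Nonempty.image _ ⟨fun _ => d, fun _ j => (hd j).le, fun j => by simp,
    fun t => utility_pos_of_pos hutil (hκ t) hd⟩) ?_
  rintro _ ⟨x, ⟨hx0, hxcap, hxU⟩, rfl⟩
  have h1 : M.welfare κ x ≤ ∑ t, (M.budget (κ t) * Real.log (M.utility (κ t) (z (κ t)))
      + ∑ j, p j * x t j - M.budget (κ t)) :=
    Finset.sum_le_sum fun t _ => budget_mul_log_le (h.utility_pos _ (hκ t))
      (h.marginal_le _ (hκ t)) (hx0 t) (hxU t)
  have h2 : ∑ t, ∑ j, p j * x t j ≤ ∑ _t : Fin n, ∑ j, p j * d j := by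
    rw [Finset.sum_comm, Finset.sum_comm (s := (Finset.univ : Finset (Fin n)))]
    refine Finset.sum_le_sum fun j _ => ?_
    rw [← Finset.mul_sum, ← Finset.mul_sum]
    refine mul_le_mul_of_nonneg_left ((hxcap j).trans (le_of_eq ?_)) (h.price_pos j).le
    simp
  rw [Finset.sum_sub_distrib, Finset.sum_add_distrib] at h1
  rw [Finset.sum_add_distrib, Finset.sum_sub_distrib]
  linarith

lemma IsEquilibrium.pathMean_offlineOptimum_le {d p : Fin m → ℝ} {z : Fin K → Fin m → ℝ}
    (h : M.IsEquilibrium d p z) (hutil : ∀ k, 0 < M.prob k → ∃ j, 0 < M.util k j)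
    (hd : ∀ j, 0 < d j) (n : ℕ) :
    M.pathMean (fun κ : Fin n → Fin K => M.offlineOptimum d κ)
      ≤ ∑ _t : Fin n, M.ceObjective z := by
  refine (pathMean_mono fun κ hκ => h.offlineOptimum_le hutil hd hκ).trans ?_
  rw [pathMean_sum]
  refine Finset.sum_le_sum fun t _ => le_of_eq ?_
  rw [pathMean_resample t (fun _ k => M.budget k * Real.log (M.utility k (z k))
      - M.budget k + ∑ j, p j * d j) fun _ _ _ => rfl, pathMean_const]
  simp_rw [mul_add, mul_sub, Finset.sum_add_distrib, Finset.sum_sub_distrib, ← Finset.sum_mul]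
  rw [M.prob_sum, h.sum_price_mul_capacity, ceObjective]
  simp_rw [mul_assoc]
  ring

namespace IsAdaptivePricing

variable {d Δ : Fin m → ℝ} {n : ℕ} {price : (Fin n → Fin K) → Fin n → Fin m → ℝ}
  {plan : (Fin n → Fin K) → Fin n → Fin K → Fin m → ℝ}

lemma pathMean_welfare (hA : M.IsAdaptivePricing d Δ price plan) :
    M.pathMean (fun κ => M.welfare κ (consumption plan κ))
      = ∑ t, M.pathMean (fun κ => M.ceObjective (plan κ t)) := by
  simp_rw [welfare]
  rw [pathMean_sum]
  refine Finset.sum_congr rfl fun t _ => ?_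
  refine (pathMean_resample (M := M) t
    (fun κ k => M.budget k * Real.log (M.utility k (plan κ t k))) fun κ κ' hκ => ?_).trans ?_
  · dsimp only
    rw [hA.plan_nonanticipating κ κ' t hκ]
  · simp_rw [ceObjective, mul_assoc]

/-- The loss of user `t` in conditional expectation. In the box it is the smoothness bound
`IsEquilibrium.ceObjective_sub_le`. Outside of it there is no loss, but the linear term of the bound
must be paid for; it is at most quadratic since the deviation is at least `δ`. -/
lemma ceObjective_sub_plan_le (hA : M.IsAdaptivePricing d Δ price plan)
    (hbuyers : M.AllGoodsHaveBuyers) (hΔ : ∀ j, 0 < Δ j ∧ Δ j < d j) {p : Fin m → ℝ}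
    {z : Fin K → Fin m → ℝ} (h : M.IsEquilibrium d p z) {l u β δ : ℝ} (hl : 0 < l) (hu : 0 < u)
    (hβ : 0 < β) (hp : ∀ j, l ≤ p j ∧ p j ≤ u)
    (hprice : ∀ κ t j, l ≤ price κ t j ∧ price κ t j ≤ u) (hβd : ∀ j, β ≤ d j - Δ j)
    (hδ : 0 < δ) (hδΔ : ∀ j, δ ≤ Δ j) (κ : Fin n → Fin K) (t : Fin n) :
    M.ceObjective z - M.ceObjective (plan κ t)
      ≤ -∑ j, p j * stoppedDev d Δ (consumption plan κ) t j
        + (((u ^ 2 / (l * β)) ^ 2 + 1) / 2 + u * (m + 1) / δ)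
          * ∑ j, stoppedDev d Δ (consumption plan κ) t j ^ 2 := by
  have hΔ0 : ∀ j, 0 < Δ j := fun j => (hΔ j).1
  have hq := h.ceObjective_sub_le (hA.isEquilibrium hbuyers hΔ κ t) hl hβ
    (fun j => (hp j).1) (fun j => (hprice κ t j).1) (fun j => (hp j).2)
    (fun j => (hprice κ t j).2)
    fun j => (hβd j).trans (by simpa using (pricingCapacity_mem_Icc (d := d) hΔ0 t).1 j)
  set η := stoppedDev d Δ (consumption plan κ) t with hη
  have hS : ∀ j ∈ Finset.univ, 0 ≤ η j ^ 2 := fun j _ => sq_nonneg _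
  have hS0 := Finset.sum_nonneg hS
  have hL : 0 ≤ ((u ^ 2 / (l * β)) ^ 2 + 1) / 2 * ∑ j, η j ^ 2 := by positivity
  by_cases hin : InBoxUntil d Δ (consumption plan κ) t
  · have hb : ∀ j, pricingCapacity d Δ (consumption plan κ) t j - d j = η j := fun j => by
      rw [pricingCapacity_eq_add_stoppedDev hΔ0 hin, add_sub_cancel_left]
    simp_rw [hb] at hq
    have : 0 ≤ u * (m + 1) / δ * ∑ j, η j ^ 2 := by positivity
    linarith
  · simp_rw [pricingCapacity_of_not_inBoxUntil hin, sub_self] at hq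
    simp only [mul_zero, Finset.sum_const_zero, neg_zero, ne_eq, OfNat.ofNat_ne_zero,
      not_false_eq_true, zero_pow, add_zero] at hq
    obtain ⟨i, hi⟩ := exists_lt_abs_stoppedDev hΔ0 hin
    have hδS : δ ^ 2 ≤ ∑ j, η j ^ 2 := by
      refine le_trans ?_ (Finset.single_le_sum hS (Finset.mem_univ i))
      rw [← sq_abs (η i)]
      exact pow_le_pow_left₀ hδ.le ((hδΔ i).trans hi.le) 2
    have hterm : ∀ j, p j * η j ≤ u / δ * (η j ^ 2 + δ ^ 2) := by
      intro j
      calc p j * η j ≤ p j * |η j| :=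
            mul_le_mul_of_nonneg_left (le_abs_self _) (h.price_pos j).le
        _ ≤ u * |η j| := mul_le_mul_of_nonneg_right (hp j).2 (abs_nonneg _)
        _ = u / δ * (δ * |η j|) := by field_simp
        _ ≤ _ := by
          refine mul_le_mul_of_nonneg_left ?_ (by positivity)
          rw [← sq_abs (η j)]
          nlinarith [sq_nonneg (|η j| - δ), abs_nonneg (η j)]
    have hsum := Finset.sum_le_sum fun j (_ : j ∈ Finset.univ) => hterm j
    rw [← Finset.mul_sum, Finset.sum_add_distrib] at hsum
    simp only [Finset.sum_const, Finset.card_univ, Fintype.card_fin, nsmul_eq_mul] at hsum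
    have h2 : u / δ * (∑ j, η j ^ 2 + m * δ ^ 2) ≤ u * (m + 1) / δ * ∑ j, η j ^ 2 := by
      have : u * (m + 1) / δ * ∑ j, η j ^ 2
          = u / δ * (∑ j, η j ^ 2 + m * ∑ j, η j ^ 2) := by ring
      rw [this]
      gcongr
    linarith

/-- The linear terms of `ceObjective_sub_plan_le` have mean zero, and the quadratic ones are of order
`1 / (n - t)`. -/
theorem pathMean_regret_le (hA : M.IsAdaptivePricing d Δ price plan)
    (hbuyers : M.AllGoodsHaveBuyers) (hutil : ∀ k, 0 < M.prob k → ∃ j, 0 < M.util k j)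
    (hΔ : ∀ j, 0 < Δ j ∧ Δ j < d j) {p : Fin m → ℝ}
    {z : Fin K → Fin m → ℝ} (h : M.IsEquilibrium d p z) {l u β δ B : ℝ} (hl : 0 < l)
    (hu : 0 < u) (hβ : 0 < β) (hp : ∀ j, l ≤ p j ∧ p j ≤ u)
    (hprice : ∀ κ t j, l ≤ price κ t j ∧ price κ t j ≤ u) (hβd : ∀ j, β ≤ d j - Δ j)
    (hB : ∀ κ : Fin n → Fin K, (∀ s, 0 < M.prob (κ s)) → ∀ t j,
      |pricingCapacity d Δ (consumption plan κ) t j - consumption plan κ t j| ≤ B)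
    (hδ : 0 < δ) (hδΔ : ∀ j, δ ≤ Δ j) :
    M.pathMean (fun κ => M.offlineOptimum d κ - M.welfare κ (consumption plan κ))
      ≤ (((u ^ 2 / (l * β)) ^ 2 + 1) / 2 + u * (m + 1) / δ) * (m * (2 * B ^ 2))
        * (1 + Real.log n) := by
  set L : ℝ := ((u ^ 2 / (l * β)) ^ 2 + 1) / 2 + u * (m + 1) / δ with hL
  have hL0 : 0 ≤ L := by positivity
  have hd : ∀ j, 0 < d j := fun j => (hΔ j).1.trans (hΔ j).2
  have hstep : ∀ t : Fin n, M.ceObjective z - M.pathMean (fun κ => M.ceObjective (plan κ t))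
      ≤ L * (m * (2 * B ^ 2)) * (1 / ((n : ℝ) - (t : ℕ))) := by
    intro t
    rw [← pathMean_const (M := M) (n := n) (M.ceObjective z), ← pathMean_sub]
    refine (pathMean_mono fun κ _ => (hA.ceObjective_sub_plan_le hbuyers hΔ h hl hu hβ hp hprice
      hβd hδ hδΔ κ t).trans (le_of_eq (neg_add_eq_sub _ _))).trans ?_
    rw [pathMean_sub, pathMean_const_mul, pathMean_sum, pathMean_sum]
    simp_rw [pathMean_const_mul, hA.pathMean_stoppedDev hbuyers hΔ _ t t.2.le]
    simp only [mul_zero, Finset.sum_const_zero, sub_zero]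
    rw [mul_assoc]
    refine mul_le_mul_of_nonneg_left ?_ hL0
    refine (Finset.sum_le_sum fun j _ =>
      (hA.pathMean_stoppedDev_pow_le hbuyers hΔ hB t j).1).trans (le_of_eq ?_)
    simp; ring
  rw [pathMean_sub, hA.pathMean_welfare]
  calc _ ≤ ∑ t : Fin n, (M.ceObjective z - M.pathMean (fun κ => M.ceObjective (plan κ t))) := by
        rw [Finset.sum_sub_distrib]
        exact sub_le_sub_right (h.pathMean_offlineOptimum_le hutil hd n) _
    _ ≤ ∑ t : Fin n, L * (m * (2 * B ^ 2)) * (1 / ((n : ℝ) - (t : ℕ))) :=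
        Finset.sum_le_sum fun t _ => hstep t
    _ ≤ _ := by
        rw [← Finset.mul_sum]
        exact mul_le_mul_of_nonneg_left (sum_inv_remaining_le n) (by positivity)

end IsAdaptivePricing

end FisherMarket

theorem theorem2 {m K : ℕ} (M : FisherMarket m K) (hbuyers : M.AllGoodsHaveBuyers)
    (hutil : ∀ k, 0 < M.prob k → ∃ j, 0 < M.util k j)
    (d Δ : Fin m → ℝ) (hΔ : ∀ j, 0 < Δ j ∧ Δ j < d j) :
    ∃ pLow pHigh C : ℝ, 0 < pLow ∧ 0 < pHigh ∧
      ∀ (n : ℕ), 0 < n →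
      ∀ (price : (Fin n → Fin K) → Fin n → Fin m → ℝ)
        (plan : (Fin n → Fin K) → Fin n → Fin K → Fin m → ℝ),
      M.IsAdaptivePricing d Δ price plan →
      ∀ (Ω : Type*) [MeasurableSpace Ω] (P : Measure Ω) [IsProbabilityMeasure P]
        (T : Fin n → Ω → Fin K), M.IsIIDArrivals P T →
        (∀ᵐ ω ∂P, ∀ t, (∀ j, pLow ≤ price (fun s => T s ω) t j ∧
            price (fun s => T s ω) t j ≤ pHigh) ∧
          IsUserOptimal (M.budget (T t ω)) (M.util (T t ω)) (price (fun s => T s ω) t)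
            (consumption plan (fun s => T s ω) t)) ∧
        expectedViolation d P T (consumption plan) ≤ C ∧
        (2 ≤ n → M.expectedRegret d P T (consumption plan) ≤ C * Real.log n) := by
  obtain ⟨l, u, B, hl, hu, hbounds⟩ := FisherMarket.exists_equilibrium_bounds hbuyers hΔ
  obtain ⟨β, hβ, hβd⟩ := exists_pos_forall_ge (fun j => d j - Δ j) fun j => sub_pos.2 (hΔ j).2
  obtain ⟨δ, hδ, hδΔ⟩ := exists_pos_forall_ge Δ fun j => (hΔ j).1
  set C₁ : ℝ := m * (1 + B + 30 * m * B ^ 4 * (B ^ 2 / δ ^ 4 + 2 / δ ^ 3)) with hC₁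
  set C₂ : ℝ := (((u ^ 2 / (l * β)) ^ 2 + 1) / 2 + u * (m + 1) / δ) * (m * (2 * B ^ 2)) with hC₂
  have hC₂0 : 0 ≤ C₂ := by positivity
  refine ⟨l, u, max C₁ (3 * C₂), hl, hu, fun n hn price plan hA Ω _ P _ T hT => ?_⟩
  have heq := hA.isEquilibrium hbuyers hΔ
  have hbox := fun κ t => pricingCapacity_mem_Icc (d := d) (x := consumption plan κ)
    (fun j => (hΔ j).1) t
  have hprice : ∀ κ t j, l ≤ price κ t j ∧ price κ t j ≤ u := fun κ t =>
    (hbounds _ (hbox κ t) _ _ (heq κ t)).1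
  have hB : ∀ κ : Fin n → Fin K, (∀ s, 0 < M.prob (κ s)) → ∀ t j,
      |pricingCapacity d Δ (consumption plan κ) t j - consumption plan κ t j| ≤ B :=
    fun κ hκ t j => (hbounds _ (hbox κ t) _ _ (heq κ t)).2 (κ t) (hκ t) j
  refine ⟨?_, ?_, fun hn2 => ?_⟩
  · filter_upwards [hT.ae_prob_pos] with ω hω t
    exact ⟨hprice _ t, (heq (fun s => T s ω) t).isUserOptimal (hω t)⟩
  · rw [expectedViolation, hT.integral_eq_pathMean fun κ => violation d (consumption plan κ)]
    exact (hA.pathMean_violation_le hbuyers hΔ hn hB hδ hδΔ).trans (le_max_left _ _)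
  · rw [FisherMarket.expectedRegret, hT.integral_eq_pathMean fun κ =>
      M.offlineOptimum d κ - M.welfare κ (consumption plan κ)]
    -- the first user is always served at capacities `d`
    obtain ⟨k₀, -⟩ := M.exists_prob_pos
    have h₀ := heq (fun _ => k₀) ⟨0, hn⟩
    have hcap : pricingCapacity d Δ (consumption plan fun _ => k₀) ⟨0, hn⟩ = d := by
      by_cases hin : InBoxUntil d Δ (consumption plan fun _ => k₀) ⟨0, hn⟩
      · rw [pricingCapacity_of_inBoxUntil hin, avgRemaining_zero]
      · exact pricingCapacity_of_not_inBoxUntil hin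
    rw [hcap] at h₀
    have hreg := hA.pathMean_regret_le hbuyers hutil hΔ h₀ hl hu hβ (hprice _ _) hprice hβd hB
      hδ hδΔ
    have hlog : 1 ≤ 2 * Real.log n := by
      have h1 : Real.log 2 ≤ Real.log n :=
        Real.log_le_log (by norm_num) (by exact_mod_cast hn2)
      linarith [Real.log_two_gt_d9]
    have hlog0 : 0 ≤ Real.log n := by linarith
    calc _ ≤ C₂ * (1 + Real.log n) := hreg
      _ ≤ C₂ * (3 * Real.log n) := mul_le_mul_of_nonneg_left (by linarith) hC₂0
      _ = 3 * C₂ * Real.log n := by ring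
      _ ≤ _ := mul_le_mul_of_nonneg_right (le_max_right _ _) hlog0
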